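/- Let $n\ge 1$, let $(W,S)$ be a Coxeter system of type $A_{n-1}$ with $S=\{s_1,\dots,s_{n-1}\}$ (so $W\cong S_n$), let $R$ be a commutative ring, and let $u\colon S\to R^\times$, $s\mapsto u_s$, be a map with $u_s=u_{t}$ whenever $s,t\in S$ are conjugate in $W$. Let $\Phi$ be the root system of $(W,S)$ in its standard geometric representation, with simple roots $\alpha_s$ ($s\in S$). A root subsystem is a (possibly empty) subset of $\Phi$ stable under the reflections in its own elements. Root subsystems form a commutative monoid $\Sigma(\Phi)$ under $\Psi_1\cdot\Psi_2=\langle\Psi_1,\Psi_2\rangle$ (the root subsystem generated by $\Psi_1\cup\Psi_2$), on which $W$ acts. Put $e_s=\langle\alpha_s\rangle=\{\pm\alpha_s\}$, let $\Sigma(\Phi)_{[e]}$ be the submonoid generated by all $w.e_s$ ($w\in W$, $s\in S$), let $A=R[\Sigma(\Phi)_{[e]}]$ be its monoid algebra with the induced $W$-action $\rho$, and let $\hat e_s=1+(u_s-1)e_s\in A^\times$. Let $B_W$ be the Artin braid group of $(W,S)$ with standard generators $g_s$, acting on $A$ through $B_W\to W$, and let $\mathcal E^{(W,S)}(A,\rho,\hat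 e)$ be the quotient of the semidirect product $A\rtimes R[B_W]$ (in which $g\,c=(g.c)\,g$ for $g\in B_W$, $c\in A$) by the two-sided ideal generated by the elements $g_s^2-\hat e_s-(1-\hat e_s)g_s$, $s\in S$. This is the Marin algebra attached to the identity homomorphism $\phi=\mathrm{id}_W$ and the map $e\colon s\mapsto\langle\alpha_s\rangle$. For $q\in R^\times$ let $\mathcal E_n=\mathcal E_n(q)$ be the Aicardi--Juyumaya algebra of braids and ties: the associative unital $R$-algebra generated by $g_1,\dots,g_{n-1},e_1,\dots,e_{n-1}$ subject to \begin{align*} g_ig_j&=g_jg_i &&\text{if } |i-j|>1,\\ g_ig_jg_i&=g_jg_ig_j &&\text{if } |i-j|=1,\\ g_i^2&=1+(q-1)e_i(1-g_i),\\ g_ie_j&=e_jg_i &&\text{if } |i-j|\neq 1,\\ g_jg_ie_j&=e_ig_jg_i &&\text{if } |i-j|=1,\\ e_ie_j&=e_je_i,\qquad e_i^2=e_i,\\ e_ie_jg_j&=e_ig_je_i=g_je_ie_j &&\text{if } |i-j|=1. \end{align*} Proposition. The map $u$ is constant: there is $q\in R^\times$ with $u_s=q$ for all $s\in S$. For every such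 $q$ the algebra $\mathcal E^{(W,S)}(R[\Sigma(\Phi)_{[e]}],\rho,\hat e)$ coincides with $\mathcal E_n(q)$: there is an isomorphism of $R$-algebras $$\mathcal E_n(q)\;\xrightarrow{\ \sim\ }\;\mathcal E^{(W,S)}(R[\Sigma(\Phi)_{[e]}],\rho,\hat e),\qquad g_i\mapsto g_{s_i},\quad e_i\mapsto e_{s_i}\qquad(1\le i\le n-1).$$ -/

import Mathlib

noncomputable section

namespace BraidsTies

/-! ### Artin groups -/

section Artin

variable {B : Type*} (M : CoxeterMatrix B)

/-- The Artin braid group attached to a Coxeter matrix: generators `B`, and for all `i, j` the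
relation between the two alternating words of length `M i j` in `i, j`
(no relation when `M i j = 0`, which encodes `∞`). -/
abbrev ArtinGroup : Type _ :=
  PresentedGroup {r : FreeGroup B | ∃ i j : B,
    r = ((CoxeterSystem.braidWord M i j).map FreeGroup.of).prod *
      (((CoxeterSystem.braidWord M j i).map FreeGroup.of).prod)⁻¹}

/-- The standard generator of the Artin group. -/
def artinGen (i : B) : ArtinGroup M := PresentedGroup.of i

variable {M} {W : Type*} [Group W] (cs : CoxeterSystem M W)

/-- The canonical projection from the Artin group to the Coxeter group. -/
def artinProj : ArtinGroup M →* W :=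
  PresentedGroup.toGroup (f := cs.simple) (by
    rintro r ⟨i, j, rfl⟩
    have h := cs.wordProd_braidWord_eq i j
    simp only [CoxeterSystem.wordProd] at h
    simp [map_list_prod, List.map_map, Function.comp_def, h])

theorem artinProj_gen (i : B) : artinProj cs (artinGen M i) = cs.simple i :=
  PresentedGroup.toGroup.of _

end Artin

/-! ### The standard geometric representation -/

section Geometric

variable {B : Type*} (M : CoxeterMatrix B)

/-- The space `V_W` of the geometric representation, with basis the simple roots. -/
abbrev GeomSpace (B : Type*) : Type _ := B →₀ ℝ

/-- The simple root `α_i`. -/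
def simpleRoot (i : B) : GeomSpace B := Finsupp.single i 1

/-- The canonical bilinear form, `⟨α_i, α_j⟩ = - cos (π / m_{ij})`. The value `M i j = 0` encodes
`m_{ij} = ∞`; then `π / 0 = 0` and the form takes the usual value `-1`. -/
def geomForm : GeomSpace B →ₗ[ℝ] GeomSpace B →ₗ[ℝ] ℝ :=
  Finsupp.linearCombination ℝ fun i => Finsupp.linearCombination ℝ fun j =>
    - Real.cos (Real.pi / (M i j : ℝ))

/-- The map `σ_v : x ↦ x - 2 ⟨v, x⟩ v`, the reflection in `v` when `⟨v, v⟩ = 1`. -/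
def refl (v : GeomSpace B) : GeomSpace B →ₗ[ℝ] GeomSpace B :=
  Module.preReflection v ((2 : ℝ) • geomForm M v)

theorem refl_apply (v x : GeomSpace B) :
    refl M v x = x - (2 * geomForm M v x) • v := by
  simp [refl, Module.preReflection_apply]

theorem geomForm_simple (i j : B) :
    geomForm M (simpleRoot i) (simpleRoot j) = - Real.cos (Real.pi / (M i j : ℝ)) := by
  simp [geomForm, simpleRoot]

theorem geomForm_simple_self (i : B) : geomForm M (simpleRoot i) (simpleRoot i) = 1 := by
  simp [geomForm_simple]

theorem geomForm_symm (x y : GeomSpace B) : geomForm M x y = geomForm M y x := by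
  have h : geomForm M = (geomForm M).flip := by
    ext i j
    have := geomForm_simple M i j
    have h2 := geomForm_simple M j i
    simp only [simpleRoot] at this h2
    simp [this, h2, M.symmetric i j]
  conv_lhs => rw [h]
  rfl

theorem two_form_simple (i : B) :
    ((2 : ℝ) • geomForm M (simpleRoot i)) (simpleRoot i) = 2 := by
  simp [geomForm_simple_self]

/-- The reflection in the simple root `α_i`, as a linear automorphism. -/
def simpleRefl (i : B) : GeomSpace B ≃ₗ[ℝ] GeomSpace B :=
  Module.reflection (two_form_simple M i)

theorem simpleRefl_apply (i : B) (x : GeomSpace B) :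
    simpleRefl M i x = refl M (simpleRoot i) x := rfl

open Polynomial.Chebyshev in
theorem simpleRefl_liftable : M.IsLiftable (simpleRefl M) := by
  intro i j
  by_cases hij : i = j
  · subst hij
    rw [M.diagonal, pow_one]
    ext1 x
    exact Module.involutive_reflection (two_form_simple M i) x
  rcases Nat.eq_zero_or_pos (M i j) with h0 | hpos
  · rw [h0, pow_zero]
  have h1 := M.off_diagonal i j hij
  set m := M i j with hm
  set c := Real.cos (Real.pi / (m : ℝ)) with hc
  have hfy : ((2 : ℝ) • geomForm M (simpleRoot i)) (simpleRoot j) = -(2 * c) := by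
    simp [geomForm_simple, hc, hm]
  have hgx : ((2 : ℝ) • geomForm M (simpleRoot j)) (simpleRoot i) = -(2 * c) := by
    simp [geomForm_simple, hc, hm, M.symmetric j i]
  apply LinearEquiv.ext
  intro z
  have key := Module.reflection_mul_reflection_pow_apply (two_form_simple M i)
    (two_form_simple M j) m z
  change ((simpleRefl M i * simpleRefl M j) ^ m) z = _ at key
  rw [key, hfy, hgx]
  by_cases h2 : m = 2
  · have hc0 : c = 0 := by
      rw [hc, h2]; simp
    rw [h2, hc0]
    norm_num [S_one]
    abel
  have h3 : 3 ≤ m := by omega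
  set θ : ℝ := 2 * (Real.pi / m) with hθ
  have ht : -(2 * c) * -(2 * c) - 2 = 2 * Real.cos θ := by
    rw [hθ, Real.cos_two_mul, hc]; ring
  have hm0 : (0 : ℝ) < m := by exact_mod_cast hpos
  have hsin : Real.sin θ ≠ 0 := by
    apply ne_of_gt
    apply Real.sin_pos_of_pos_of_lt_pi
    · positivity
    · rw [hθ]
      have : (3 : ℝ) ≤ m := by exact_mod_cast h3
      rw [← mul_div_assoc, div_lt_iff₀ hm0]
      nlinarith [Real.pi_pos]
  have hS (k : ℤ) := S_two_mul_real_cos θ k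
  have hθm : (m : ℝ) * θ = 2 * Real.pi := by rw [hθ]; field_simp
  rw [ht]
  obtain ⟨k, hk | hk⟩ := Nat.even_or_odd' m
  · have e1 : ((m : ℤ) - 2) / 2 = k - 1 := by omega
    have e2 : ((m : ℤ) - 1) / 2 = k - 1 := by omega
    have z1 : (S ℝ ((k : ℤ) - 1)).eval (2 * Real.cos θ) = 0 := by
      have := hS ((k : ℤ) - 1)
      have hz : ((((k : ℤ) - 1 : ℤ) : ℝ) + 1) * θ = Real.pi := by
        push_cast
        have : (m : ℝ) = 2 * k := by exact_mod_cast hk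
        rw [this] at hθm
        linarith
      rw [hz, Real.sin_pi] at this
      exact (mul_eq_zero.mp this).resolve_right hsin
    rw [e1, e2, z1]
    simp
  · have e1 : ((m : ℤ) - 2) / 2 = k - 1 := by omega
    have e2 : ((m : ℤ) - 1) / 2 = k := by omega
    have e3 : ((m : ℤ) - 3) / 2 = k - 1 := by omega
    have e4 : (m : ℤ) / 2 = k := by omega
    have z1 : (S ℝ (k : ℤ)).eval (2 * Real.cos θ) +
        (S ℝ ((k : ℤ) - 1)).eval (2 * Real.cos θ) = 0 := by
      have a1 := hS (k : ℤ)
      have a2 := hS ((k : ℤ) - 1)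
      have hz : ((k : ℝ) + 1) * θ = 2 * Real.pi - k * θ := by
        have : (m : ℝ) = 2 * k + 1 := by exact_mod_cast hk
        rw [this] at hθm
        linarith
      have hz2 : ((((k : ℤ) - 1 : ℤ) : ℝ) + 1) * θ = k * θ := by push_cast; ring
      rw [hz2] at a2
      rw [Int.cast_natCast, hz, Real.sin_two_pi_sub] at a1
      have : ((S ℝ (k : ℤ)).eval (2 * Real.cos θ) +
        (S ℝ ((k : ℤ) - 1)).eval (2 * Real.cos θ)) * Real.sin θ = 0 := by
        rw [add_mul, a1, a2]; ring
      exact (mul_eq_zero.mp this).resolve_right hsin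
    rw [e1, e2, e3, e4, z1]
    simp

variable {M} {W : Type*} [Group W] (cs : CoxeterSystem M W)

/-- The standard geometric representation, sending `s_i` to the reflection in `α_i`. -/
def geomRep : W →* (GeomSpace B ≃ₗ[ℝ] GeomSpace B) :=
  cs.lift ⟨simpleRefl M, simpleRefl_liftable M⟩

theorem geomRep_simple (i : B) : geomRep cs (cs.simple i) = simpleRefl M i :=
  cs.lift_apply_simple (simpleRefl_liftable M) i

theorem geomForm_geomRep (w : W) (x y : GeomSpace B) :
    geomForm M (geomRep cs w x) (geomRep cs w y) = geomForm M x y := by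
  induction w using cs.simple_induction generalizing x y with
  | simple i =>
    simp only [geomRep_simple, simpleRefl_apply, refl_apply, map_sub, map_smul,
      LinearMap.sub_apply, LinearMap.smul_apply, smul_eq_mul, geomForm_simple_self,
      geomForm_symm M x (simpleRoot i)]
    ring
  | one => simp
  | mul w w' h h' => simp [LinearEquiv.mul_apply, h, h']

theorem refl_geomRep (w : W) (v x : GeomSpace B) :
    refl M (geomRep cs w v) (geomRep cs w x) = geomRep cs w (refl M v x) := by
  simp [refl_apply, geomForm_geomRep]

/-- The root system `Φ_W`: the orbit of the simple roots. -/
def roots : Set (GeomSpace B) := {v | ∃ (w : W) (i : B), v = geomRep cs w (simpleRoot i)}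

theorem geomRep_mem_roots (w : W) {v : GeomSpace B} (hv : v ∈ roots cs) :
    geomRep cs w v ∈ roots cs := by
  obtain ⟨w', i, rfl⟩ := hv
  exact ⟨w * w', i, by simp [LinearEquiv.mul_apply]⟩

theorem refl_simple_conj (w : W) (i : B) (x : GeomSpace B) :
    refl M (geomRep cs w (simpleRoot i)) x = geomRep cs (w * cs.simple i * w⁻¹) x := by
  have h := refl_geomRep cs w (simpleRoot i) (geomRep cs w⁻¹ x)
  rw [← LinearEquiv.mul_apply, ← map_mul, mul_inv_cancel, map_one, LinearEquiv.coe_one, id] at h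
  rw [h, ← simpleRefl_apply, ← geomRep_simple cs i, ← LinearEquiv.mul_apply,
    ← LinearEquiv.mul_apply, ← map_mul, ← map_mul]

theorem refl_mem_roots {v x : GeomSpace B} (hv : v ∈ roots cs) (hx : x ∈ roots cs) :
    refl M v x ∈ roots cs := by
  obtain ⟨w, i, rfl⟩ := hv
  rw [refl_simple_conj]
  exact geomRep_mem_roots cs _ hx

end Geometric

/-! ### The monoid of root subsystems -/

/-- A root subsystem of `Φ_W`: a (possibly empty) set of roots that is stable under the
reflections in its own elements. -/
@[ext]
structure RootSubsystem {B : Type*} {M : CoxeterMatrix B} {W : Type*} [Group W]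
    (cs : CoxeterSystem M W) where
  carrier : Set (GeomSpace B)
  subset_roots : carrier ⊆ roots cs
  refl_mem : ∀ v ∈ carrier, ∀ x ∈ carrier, refl M v x ∈ carrier

namespace RootSubsystem

variable {B : Type*} {M : CoxeterMatrix B} {W : Type*} [Group W] {cs : CoxeterSystem M W}

/-- The root subsystem `⟨X⟩` generated by a set `X` of roots: the intersection of all root
subsystems that contain `X`. -/
def generate (X : Set (GeomSpace B)) (hX : X ⊆ roots cs) : RootSubsystem cs where
  carrier := {v | ∀ Ψ : RootSubsystem cs, X ⊆ Ψ.carrier → v ∈ Ψ.carrier}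
  subset_roots := fun _ hv =>
    hv ⟨roots cs, subset_rfl, fun _ h _ h' => refl_mem_roots cs h h'⟩ hX
  refl_mem := fun v hv x hx Ψ hΨ => Ψ.refl_mem v (hv Ψ hΨ) x (hx Ψ hΨ)

theorem subset_generate (X : Set (GeomSpace B)) (hX : X ⊆ roots cs) :
    X ⊆ (generate X hX).carrier := fun _ hv _ hΨ => hΨ hv

theorem generate_subset {X : Set (GeomSpace B)} {hX : X ⊆ roots cs} {Ψ : RootSubsystem cs}
    (h : X ⊆ Ψ.carrier) : (generate X hX).carrier ⊆ Ψ.carrier := fun _ hv => hv Ψ h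

/-- The composition law: `Ψ₁ * Ψ₂ = ⟨Ψ₁, Ψ₂⟩`. -/
instance : Mul (RootSubsystem cs) :=
  ⟨fun Ψ₁ Ψ₂ => generate (Ψ₁.carrier ∪ Ψ₂.carrier)
    (Set.union_subset Ψ₁.subset_roots Ψ₂.subset_roots)⟩

/-- The unit is the empty root subsystem. -/
instance : One (RootSubsystem cs) :=
  ⟨⟨∅, Set.empty_subset _, fun _ h => absurd h (Set.notMem_empty _)⟩⟩

theorem mul_subset_iff {Ψ₁ Ψ₂ Ψ : RootSubsystem cs} :
    (Ψ₁ * Ψ₂).carrier ⊆ Ψ.carrier ↔ Ψ₁.carrier ⊆ Ψ.carrier ∧ Ψ₂.carrier ⊆ Ψ.carrier := by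
  constructor
  · intro h
    have h' := (subset_generate (cs := cs) (Ψ₁.carrier ∪ Ψ₂.carrier)
      (Set.union_subset Ψ₁.subset_roots Ψ₂.subset_roots)).trans h
    exact Set.union_subset_iff.mp h'
  · intro h
    exact generate_subset (Set.union_subset_iff.mpr h)

theorem ext_of_subset_iff {Ψ₁ Ψ₂ : RootSubsystem cs}
    (h : ∀ Ψ : RootSubsystem cs, Ψ₁.carrier ⊆ Ψ.carrier ↔ Ψ₂.carrier ⊆ Ψ.carrier) : Ψ₁ = Ψ₂ :=
  RootSubsystem.ext (((h Ψ₂).mpr subset_rfl).antisymm ((h Ψ₁).mp subset_rfl))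

instance : CommMonoid (RootSubsystem cs) where
  mul_assoc a b c := ext_of_subset_iff fun Ψ => by simp only [mul_subset_iff, and_assoc]
  one_mul a := ext_of_subset_iff fun Ψ => by
    rw [mul_subset_iff]
    exact ⟨fun h => h.2, fun h => ⟨Set.empty_subset _, h⟩⟩
  mul_one a := ext_of_subset_iff fun Ψ => by
    rw [mul_subset_iff]
    exact ⟨fun h => h.1, fun h => ⟨h, Set.empty_subset _⟩⟩
  mul_comm a b := ext_of_subset_iff fun Ψ => by simp only [mul_subset_iff, and_comm]

theorem mul_self (Ψ : RootSubsystem cs) : Ψ * Ψ = Ψ :=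
  ext_of_subset_iff fun Ψ' => by simp only [mul_subset_iff, and_self]

/-- The action of `W` on root subsystems, through the geometric representation. -/
instance : MulAction W (RootSubsystem cs) where
  smul w Ψ :=
    { carrier := geomRep cs w '' Ψ.carrier
      subset_roots := by
        rintro _ ⟨v, hv, rfl⟩
        exact geomRep_mem_roots cs w (Ψ.subset_roots hv)
      refl_mem := by
        rintro _ ⟨v, hv, rfl⟩ _ ⟨x, hx, rfl⟩
        exact ⟨_, Ψ.refl_mem v hv x hx, (refl_geomRep cs w v x).symm⟩ }
  one_smul Ψ := by
    apply RootSubsystem.ext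
    change geomRep cs 1 '' Ψ.carrier = Ψ.carrier
    simp
  mul_smul w w' Ψ := by
    apply RootSubsystem.ext
    change geomRep cs (w * w') '' Ψ.carrier = geomRep cs w '' (geomRep cs w' '' Ψ.carrier)
    rw [Set.image_image, map_mul]
    rfl

theorem smul_carrier (w : W) (Ψ : RootSubsystem cs) :
    (w • Ψ).carrier = geomRep cs w '' Ψ.carrier := rfl

theorem smul_subset_smul (w : W) {Ψ Ψ' : RootSubsystem cs} (h : Ψ.carrier ⊆ Ψ'.carrier) :
    (w • Ψ).carrier ⊆ (w • Ψ').carrier := Set.image_mono h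

theorem smul_subset_iff {w : W} {Ψ Ψ' : RootSubsystem cs} :
    (w • Ψ).carrier ⊆ Ψ'.carrier ↔ Ψ.carrier ⊆ (w⁻¹ • Ψ').carrier := by
  constructor <;> intro h
  · simpa using smul_subset_smul w⁻¹ h
  · simpa using smul_subset_smul w h

instance : MulDistribMulAction W (RootSubsystem cs) where
  smul_mul w a b := ext_of_subset_iff fun Ψ => by
    simp only [mul_subset_iff, smul_subset_iff]
  smul_one w := by
    apply RootSubsystem.ext
    change geomRep cs w '' (∅ : Set _) = ∅
    simp

variable (cs) in
/-- The root subsystem `⟨s_i⟩ = ⟨α_i⟩` generated by the simple root `α_i`. -/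
def ofSimple (i : B) : RootSubsystem cs :=
  generate {simpleRoot i} (Set.singleton_subset_iff.mpr ⟨1, i, by simp⟩)

theorem ofSimple_subset_iff {i : B} {Ψ : RootSubsystem cs} :
    (ofSimple cs i).carrier ⊆ Ψ.carrier ↔ simpleRoot i ∈ Ψ.carrier :=
  ⟨fun h => h (subset_generate _ _ rfl),
    fun h => generate_subset (Set.singleton_subset_iff.mpr h)⟩

theorem neg_mem {Ψ : RootSubsystem cs} {v : GeomSpace B} (h : v ∈ Ψ.carrier) :
    -v ∈ Ψ.carrier := by
  have h1 := Ψ.refl_mem v h v h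
  obtain ⟨w, i, hv⟩ := Ψ.subset_roots h
  have h2 : geomForm M v v = 1 := by rw [hv, geomForm_geomRep, geomForm_simple_self]
  rw [refl_apply, h2] at h1
  convert h1 using 1
  module

theorem smul_ofSimple {w : W} {i j : B} (h : w * cs.simple i * w⁻¹ = cs.simple j) :
    w • ofSimple cs i = ofSimple cs j := by
  set β := geomRep cs w (simpleRoot i) with hβ
  have hβ1 : geomForm M β β = 1 := by rw [hβ, geomForm_geomRep, geomForm_simple_self]
  have h1 : refl M β β = refl M (simpleRoot j) β := by
    rw [hβ, refl_simple_conj, h, geomRep_simple, simpleRefl_apply]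
  rw [refl_apply, refl_apply, hβ1] at h1
  set c := geomForm M (simpleRoot j) β with hc
  have h2 : β = c • simpleRoot j := by
    have h4 : (2 : ℝ) • β = (2 : ℝ) • (c • simpleRoot j) := by
      rw [smul_smul]
      have := sub_right_injective h1
      simpa using this
    exact smul_right_injective _ (two_ne_zero (α := ℝ)) h4
  have h3 : c = 1 ∨ c = -1 := by
    rw [h2] at hβ1
    simp only [map_smul, LinearMap.smul_apply, geomForm_simple_self, smul_eq_mul, mul_one] at hβ1
    exact mul_self_eq_one_iff.mp hβ1
  refine ext_of_subset_iff fun Ψ => ?_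
  rw [smul_subset_iff, ofSimple_subset_iff, ofSimple_subset_iff, smul_carrier]
  have h5 : simpleRoot i ∈ geomRep cs w⁻¹ '' Ψ.carrier ↔ β ∈ Ψ.carrier := by
    constructor
    · rintro ⟨x, hx, hxi⟩
      rw [hβ, ← hxi, ← LinearEquiv.mul_apply, ← map_mul]
      simpa using hx
    · intro hx
      refine ⟨β, hx, ?_⟩
      rw [hβ, ← LinearEquiv.mul_apply, ← map_mul]
      simp
  rw [h5, h2]
  rcases h3 with h3 | h3 <;> rw [h3]
  · simp
  · rw [neg_one_smul]
    exact ⟨fun hx => by simpa using neg_mem hx, neg_mem⟩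

theorem ofSimple_mul_smul (i : B) (Ψ : RootSubsystem cs) :
    ofSimple cs i * Ψ = ofSimple cs i * (cs.simple i • Ψ) := by
  have key (Ψ : RootSubsystem cs) (Θ : RootSubsystem cs) (hi : simpleRoot i ∈ Θ.carrier)
      (h : Ψ.carrier ⊆ Θ.carrier) : (cs.simple i • Ψ).carrier ⊆ Θ.carrier := by
    rintro _ ⟨x, hx, rfl⟩
    rw [geomRep_simple, simpleRefl_apply]
    exact Θ.refl_mem _ hi _ (h hx)
  refine ext_of_subset_iff fun Θ => ?_
  rw [mul_subset_iff, mul_subset_iff, ofSimple_subset_iff]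
  refine and_congr_right fun hi => ⟨key Ψ Θ hi, fun h => ?_⟩
  have := key _ Θ hi h
  rwa [smul_smul, cs.simple_mul_simple_self, one_smul] at this

end RootSubsystem

/-! ### Marin rings -/

section Marin

variable {B : Type*} {M : CoxeterMatrix B} {W : Type*} [Group W] (cs : CoxeterSystem M W)

/-- Equivariance of a map `S → X` into a type with trivial `W`-action, for the conjugation action
on `W`: the map is constant on simple reflections that are conjugate in `W`. -/
def ConjInvariant {X : Type*} (u : B → X) : Prop :=
  ∀ (i j : B) (w : W), w * cs.simple i * w⁻¹ = cs.simple j → u i = u j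

/-- The data `(A, ρ, a)` which together with the Coxeter system `cs` form a Marin datum. -/
structure MarinDatum (k A : Type*) [CommRing k] [CommRing A] [Algebra k A] where
  /-- the action of `W` on `A` -/
  ρ : W →* (A ≃ₐ[k] A)
  /-- the units `a_s` -/
  a : B → Aˣ
  equivariant : ∀ (i j : B) (w : W), w * cs.simple i * w⁻¹ = cs.simple j →
    ρ w (a i : A) = (a j : A)

namespace MarinDatum

variable {cs} {k A : Type*} [CommRing k] [CommRing A] [Algebra k A] (D : MarinDatum cs k A)

/-- The Artin group, as a type that remembers the Marin datum and so acts on `A`. -/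
def Braid (_D : MarinDatum cs k A) : Type _ := ArtinGroup M

instance : Group D.Braid := inferInstanceAs (Group (ArtinGroup M))

/-- The projection from the Artin group to `W`. -/
def proj : D.Braid →* W := artinProj cs

/-- The Artin generator `g_s`. -/
def braidGen (i : B) : D.Braid := artinGen M i

/-- The Artin group acts on `A` through its projection to `W`. -/
instance : MulSemiringAction D.Braid A := MulSemiringAction.compHom A (D.ρ.comp D.proj)

theorem braid_smul (g : D.Braid) (c : A) : g • c = D.ρ (D.proj g) c := rfl

instance : SMulCommClass D.Braid k A := ⟨fun g r c => map_smul (D.ρ (D.proj g)) r c⟩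

/-- The semidirect product `A ⋊ k[B_W]`: the free left `A`-module on the Artin group, with the
multiplication `(c g) (d h) = (c * (g • d)) (g h)`. Here `SkewMonoidAlgebra.single g c` is the
element `c g`. -/
abbrev SemidirectProduct : Type _ := SkewMonoidAlgebra A D.Braid

/-- The element `g_s` of the semidirect product. -/
def sgen (i : B) : D.SemidirectProduct := SkewMonoidAlgebra.single (D.braidGen i) 1

/-- The element `c` of `A` in the semidirect product. -/
def scoeff (c : A) : D.SemidirectProduct := SkewMonoidAlgebra.single 1 c

/-- The defining relators `g_s ^ 2 - a_s - (1 - a_s) g_s` of the Marin ring. -/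
inductive Rel : D.SemidirectProduct → D.SemidirectProduct → Prop
  | quadratic (i : B) : Rel
      (D.sgen i ^ 2 - D.scoeff (D.a i : A) - D.scoeff (1 - (D.a i : A)) * D.sgen i) 0

/-- The Marin ring: the quotient of the semidirect product `A ⋊ k[B_W]` by the two-sided ideal
generated by the elements `g_s ^ 2 - a_s - (1 - a_s) g_s`. -/
abbrev MarinRing : Type _ := RingQuot D.Rel

/-- The class of an Artin generator in the Marin ring. -/
def gen (i : B) : D.MarinRing := RingQuot.mkAlgHom k D.Rel (D.sgen i)

/-- The class of an element of `A` in the Marin ring. -/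
def coeff (c : A) : D.MarinRing := RingQuot.mkAlgHom k D.Rel (D.scoeff c)

end MarinDatum

end Marin

/-! ### Juyumaya maps and the associated algebras -/

/-- A Juyumaya map `(φ, e)` between Coxeter systems `(W, S)` and `(U, T)`. -/
structure JuyumayaMap {B C : Type*} {M : CoxeterMatrix B} {N : CoxeterMatrix C}
    {W U : Type*} [Group W] [Group U] (cs : CoxeterSystem M W) (ct : CoxeterSystem N U) where
  /-- the group homomorphism -/
  φ : W →* U
  /-- the map to root subsystems -/
  e : B → RootSubsystem ct
  equivariant : ∀ (i j : B) (w : W), w * cs.simple i * w⁻¹ = cs.simple j → φ w • e i = e j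
  tie : ∀ (i j : B) (w : W), e i * (φ w • e j) = e i * (φ (cs.simple i * w) • e j)

namespace JuyumayaMap

variable {B C : Type*} {M : CoxeterMatrix B} {N : CoxeterMatrix C}
  {W U : Type*} [Group W] [Group U] {cs : CoxeterSystem M W} {ct : CoxeterSystem N U}

variable (cs) in
/-- The identity Juyumaya map `s ↦ ⟨s⟩` of a Coxeter system. -/
def identity : JuyumayaMap cs cs where
  φ := MonoidHom.id W
  e := RootSubsystem.ofSimple cs
  equivariant _ _ _ h := RootSubsystem.smul_ofSimple h
  tie i j w := by
    rw [MonoidHom.id_apply, MonoidHom.id_apply, mul_smul]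
    exact RootSubsystem.ofSimple_mul_smul i _

variable (J : JuyumayaMap cs ct)

/-- The submonoid `Σ(Φ_U)_{[e]}` generated by the elements `w • e_s`. -/
def ties : Submonoid (RootSubsystem ct) :=
  Submonoid.closure {x | ∃ (w : W) (i : B), x = J.φ w • J.e i}

theorem smul_mem_ties (w : W) {x : RootSubsystem ct} (hx : x ∈ J.ties) : J.φ w • x ∈ J.ties := by
  induction hx using Submonoid.closure_induction with
  | mem x hx =>
    obtain ⟨w', i, rfl⟩ := hx
    exact Submonoid.subset_closure ⟨w * w', i, by rw [map_mul, mul_smul]⟩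
  | one => rw [smul_one]; exact one_mem _
  | mul x y _ _ hx hy => rw [smul_mul']; exact mul_mem hx hy

/-- The element `e_s` of `Σ(Φ_U)_{[e]}`. -/
def tie' (i : B) : J.ties :=
  ⟨J.e i, Submonoid.subset_closure ⟨1, i, by simp⟩⟩

/-- The action of `W` on the monoid `Σ(Φ_U)_{[e]}`. -/
def tiesAction : W →* MulAut J.ties where
  toFun w :=
    { toFun := fun x => ⟨J.φ w • (x : RootSubsystem ct), J.smul_mem_ties w x.2⟩
      invFun := fun x => ⟨J.φ w⁻¹ • (x : RootSubsystem ct), J.smul_mem_ties w⁻¹ x.2⟩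
      left_inv := fun x => by ext1; simp
      right_inv := fun x => by ext1; simp
      map_mul' := fun x y => by ext1; simp [smul_mul'] }
  map_one' := by ext1 x; ext1; simp
  map_mul' w w' := by ext1 x; ext1; simp [mul_smul]

variable (R : Type*) [CommRing R]

/-- The induced action `ρ_φ` of `W` on the monoid algebra `R[Σ(Φ_U)_{[e]}]`. -/
def tiesAlgAction : W →* (MonoidAlgebra R J.ties ≃ₐ[R] MonoidAlgebra R J.ties) where
  toFun w := MonoidAlgebra.domCongr R R (J.tiesAction w)
  map_one' := by
    rw [map_one]
    exact MonoidAlgebra.domCongr_refl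
  map_mul' w w' := by
    rw [map_mul]
    apply AlgEquiv.ext
    intro x
    induction x using MonoidAlgebra.induction_linear with
    | zero => simp
    | add x y hx hy => rw [map_add, map_add, hx, hy]
    | single m r => simp [AlgEquiv.mul_apply]

variable {R}

/-- The element `e_s` of the monoid algebra `R[Σ(Φ_U)_{[e]}]`. -/
def tieElt (i : B) : MonoidAlgebra R J.ties := MonoidAlgebra.of R J.ties (J.tie' i)

theorem tieElt_mul_self (i : B) : J.tieElt (R := R) i * J.tieElt i = J.tieElt i := by
  rw [tieElt, ← map_mul]
  congr 1
  exact Subtype.ext (RootSubsystem.mul_self _)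

/-- The units `ê_s = 1 + (u_s - 1) e_s`, with inverse `1 + u_s⁻¹ (1 - u_s) e_s`. -/
def hatE (u : B → Rˣ) (i : B) : (MonoidAlgebra R J.ties)ˣ where
  val := 1 + ((u i : R) - 1) • J.tieElt i
  inv := 1 + (((u i)⁻¹ : Rˣ) * (1 - (u i : R))) • J.tieElt i
  val_inv := by
    have h := J.tieElt_mul_self (R := R) i
    have hu : (((u i)⁻¹ : Rˣ) : R) * (u i : R) = 1 := Units.inv_mul _
    rw [add_mul, mul_add, mul_add, smul_mul_smul_comm, h, one_mul, one_mul, mul_one, add_assoc,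
      ← add_smul, ← add_smul]
    rw [show (((u i)⁻¹ : Rˣ) : R) * (1 - (u i : R)) + ((u i : R) - 1 + ((u i : R) - 1) *
      ((((u i)⁻¹ : Rˣ) : R) * (1 - (u i : R)))) = 0 by linear_combination (1 - (u i : R)) * hu]
    simp
  inv_val := by
    have h := J.tieElt_mul_self (R := R) i
    have hu : (((u i)⁻¹ : Rˣ) : R) * (u i : R) = 1 := Units.inv_mul _
    rw [add_mul, mul_add, mul_add, smul_mul_smul_comm, h, one_mul, one_mul, mul_one, add_assoc,
      ← add_smul, ← add_smul]
    rw [show ((u i : R) - 1) + ((((u i)⁻¹ : Rˣ) : R) * (1 - (u i : R)) +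
      ((((u i)⁻¹ : Rˣ) : R) * (1 - (u i : R))) * ((u i : R) - 1)) = 0 by
        linear_combination (1 - (u i : R)) * hu]
    simp

/-- The Marin datum `(R[Σ(Φ_U)_{[e]}], ρ_φ, ê)`. -/
def marinDatum (u : B → Rˣ) (hu : ConjInvariant cs u) :
    MarinDatum cs R (MonoidAlgebra R J.ties) where
  ρ := J.tiesAlgAction R
  a := J.hatE u
  equivariant i j w h := by
    have h1 : J.tiesAction w (J.tie' i) = J.tie' j := Subtype.ext (J.equivariant i j w h)
    have h2 : J.tiesAlgAction R w (J.tieElt i) = J.tieElt j := by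
      simp [tiesAlgAction, tieElt, h1]
    simp [hatE, h2, hu i j w h]

end JuyumayaMap

/-! ### The algebra of braids and ties of type A -/

/-- Generators `g_1, …, g_{n-1}, e_1, …, e_{n-1}` (indexed from `0`). -/
inductive BTGen (n : ℕ) : Type
  | g (i : Fin (n - 1))
  | e (i : Fin (n - 1))

/-- The distance `|i - j|` of two indices. -/
def idxDist {m : ℕ} (i j : Fin m) : ℤ := |((i : ℕ) : ℤ) - ((j : ℕ) : ℤ)|

section BT

variable (R : Type*) [CommRing R] (n : ℕ)

/-- The generator `g_i` in the free algebra. -/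
def fg (i : Fin (n - 1)) : FreeAlgebra R (BTGen n) := FreeAlgebra.ι R (BTGen.g i)

/-- The generator `e_i` in the free algebra. -/
def fe (i : Fin (n - 1)) : FreeAlgebra R (BTGen n) := FreeAlgebra.ι R (BTGen.e i)

/-- The defining relations of the algebra of braids and ties with parameter `q`. -/
inductive BTRel (q : R) : FreeAlgebra R (BTGen n) → FreeAlgebra R (BTGen n) → Prop
  | gg (i j) : 1 < idxDist i j → BTRel q (fg R n i * fg R n j) (fg R n j * fg R n i)
  | ggg (i j) : idxDist i j = 1 →
      BTRel q (fg R n i * fg R n j * fg R n i) (fg R n j * fg R n i * fg R n j)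
  | quadratic (i) : BTRel q (fg R n i ^ 2) (1 + (q - 1) • (fe R n i * (1 - fg R n i)))
  | ge (i j) : idxDist i j ≠ 1 → BTRel q (fg R n i * fe R n j) (fe R n j * fg R n i)
  | gge (i j) : idxDist i j = 1 →
      BTRel q (fg R n j * fg R n i * fe R n j) (fe R n i * fg R n j * fg R n i)
  | ee (i j) : BTRel q (fe R n i * fe R n j) (fe R n j * fe R n i)
  | idem (i) : BTRel q (fe R n i ^ 2) (fe R n i)
  | eeg (i j) : idxDist i j = 1 →
      BTRel q (fe R n i * fe R n j * fg R n j) (fe R n i * fg R n j * fe R n i)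
  | ege (i j) : idxDist i j = 1 →
      BTRel q (fe R n i * fg R n j * fe R n i) (fg R n j * fe R n i * fe R n j)

/-- The algebra `𝓔_n` of braids and ties over `R` with parameter `q`. -/
abbrev BTAlgebra (q : R) : Type _ := RingQuot (BTRel R n q)

variable {R n}

/-- The generator `g_i` of `𝓔_n`. -/
def BTAlgebra.g (q : R) (i : Fin (n - 1)) : BTAlgebra R n q :=
  RingQuot.mkAlgHom R (BTRel R n q) (fg R n i)

/-- The generator `e_i` of `𝓔_n`. -/
def BTAlgebra.e (q : R) (i : Fin (n - 1)) : BTAlgebra R n q :=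
  RingQuot.mkAlgHom R (BTRel R n q) (fe R n i)

end BT

end BraidsTies

end

/-!
In the algebra of braids and ties, let `τ_i = e_i` for `i < m = n - 1`. Conjugation by the `g_i`
transports these elements around, and the relations make this an action on ties `τ_{ab}` indexed by
pairs `{a, b} ⊆ {0, …, m}`, through the permutation representation of the Coxeter group. For
distinct `a`, `b`, `d` one has `τ_{ab} τ_{bd} = τ_{ab} τ_{ad}`, so the pairs whose tie a fixed
element `x` absorbs, in the sense `τ_{ab} x = x`, form an equivalence relation, that is, a root
subsystem `Θ x` of type `A`. A product of ties is absorbed by `x` if and only if the root subsystem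
generated by these ties lies in `Θ x`. Since products of commuting idempotents are determined by
the elements absorbing them, a product of ties depends only on the root subsystem it generates.
This yields a homomorphism on the monoid algebra of root subsystems, which extends to the Marin
algebra, and so the two algebras share a universal property.
-/

noncomputable section

namespace BraidsTies

section CommutingIdempotents

variable {I X : Type*} [Monoid X]

theorem commute_freeMonoid_lift {t : I → X} {a : X} (h : ∀ i, Commute (t i) a)
    (v : FreeMonoid I) : Commute (FreeMonoid.lift t v) a := by
  induction v using FreeMonoid.inductionOn' with
  | one => rw [map_one]; exact Commute.one_left a
  | of_mul i v ih => rw [map_mul, FreeMonoid.lift_eval_of]; exact (h i).mul_left ih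

variable {t : I → X} (hidem : ∀ i, IsIdempotentElem (t i)) (hcomm : ∀ i j, Commute (t i) (t j))
include hcomm

theorem commute_freeMonoid_lift_lift (v w : FreeMonoid I) :
    Commute (FreeMonoid.lift t v) (FreeMonoid.lift t w) :=
  commute_freeMonoid_lift (fun i => (commute_freeMonoid_lift (fun j => hcomm j i) w).symm) v

include hidem

theorem isIdempotentElem_freeMonoid_lift (v : FreeMonoid I) :
    IsIdempotentElem (FreeMonoid.lift t v) := by
  induction v using FreeMonoid.inductionOn' with
  | one => rw [map_one]; exact IsIdempotentElem.one
  | of_mul i v ih =>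
    rw [map_mul, FreeMonoid.lift_eval_of]
    exact (hidem i).mul_of_commute (commute_freeMonoid_lift (hcomm · i) v).symm ih

theorem freeMonoid_lift_of_mul_mul_eq_iff (i : I) (v : FreeMonoid I) (x : X) :
    FreeMonoid.lift t (FreeMonoid.of i * v) * x = x ↔
      t i * x = x ∧ FreeMonoid.lift t v * x = x := by
  have hv := isIdempotentElem_freeMonoid_lift hidem hcomm v
  have hiv := commute_freeMonoid_lift (hcomm · i) v
  rw [map_mul, FreeMonoid.lift_eval_of]
  refine ⟨fun h => ⟨?_, ?_⟩, fun ⟨hi, hx⟩ => by rw [mul_assoc, hx, hi]⟩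
  · rw [← h, ← mul_assoc, ← mul_assoc, (hidem i).eq]
  · rw [← h, ← hiv.eq, ← mul_assoc, ← mul_assoc, hv.eq]

/-- One may think of `P y x` as asserting that `y` divides `Θ x`, for a map `Θ` into an idempotent
monoid: a product of commuting idempotents is determined by the elements absorbing it. -/
theorem exists_monoidHom_of_absorbs {Y : Type*} [Monoid Y] {s : I → Y}
    (hs : Submonoid.closure (Set.range s) = ⊤) (P : Y → X → Prop) (hone : ∀ x, P 1 x)
    (hmul : ∀ y y' x, P (y * y') x ↔ P y x ∧ P y' x) (hgen : ∀ i x, P (s i) x ↔ t i * x = x) :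
    ∃ F : Y →* X, ∀ i, F (s i) = t i := by
  have habsorbs (v : FreeMonoid I) (x : X) :
      P (FreeMonoid.lift s v) x ↔ FreeMonoid.lift t v * x = x := by
    induction v using FreeMonoid.inductionOn' with
    | one => simp only [map_one, one_mul, hone]
    | of_mul i v ih =>
      rw [freeMonoid_lift_of_mul_mul_eq_iff hidem hcomm, map_mul, hmul, FreeMonoid.lift_eval_of,
        hgen, ih]
  have hker : Con.ker (FreeMonoid.lift s) ≤ Con.ker (FreeMonoid.lift t) := by
    intro v w hvw
    rw [Con.ker_rel] at hvw ⊢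
    have hmul_self (v : FreeMonoid I) := isIdempotentElem_freeMonoid_lift hidem hcomm v
    have hvw' : FreeMonoid.lift t v * FreeMonoid.lift t w = FreeMonoid.lift t w := by
      rw [← habsorbs, hvw, habsorbs, (hmul_self w).eq]
    have hwv : FreeMonoid.lift t w * FreeMonoid.lift t v = FreeMonoid.lift t v := by
      rw [← habsorbs, ← hvw, habsorbs, (hmul_self v).eq]
    rw [← hwv, (commute_freeMonoid_lift_lift hcomm w v).eq, hvw']
  have hsurj : Function.Surjective (FreeMonoid.lift s) := by
    rw [← MonoidHom.mrange_eq_top, FreeMonoid.mrange_lift, hs]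
  let equiv := Con.quotientKerEquivOfSurjective (FreeMonoid.lift s) hsurj
  refine ⟨(Con.lift _ _ hker).comp equiv.symm.toMonoidHom, fun i => ?_⟩
  have hi : equiv.symm (s i) = (FreeMonoid.of i : FreeMonoid I) := by
    rw [MulEquiv.symm_apply_eq]
    exact (FreeMonoid.lift_eval_of s i).symm
  simp only [MonoidHom.comp_apply, MulEquiv.toMonoidHom_eq_coe, MonoidHom.coe_coe, hi,
    Con.lift_coe, FreeMonoid.lift_eval_of]

end CommutingIdempotents

namespace RootSubsystem

variable {B : Type*} {M : CoxeterMatrix B} {W : Type*} [Group W] {cs : CoxeterSystem M W}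

theorem smul_ofSimple_subset_iff {w : W} {i : B} {Ψ : RootSubsystem cs} :
    (w • ofSimple cs i).carrier ⊆ Ψ.carrier ↔ geomRep cs w (simpleRoot i) ∈ Ψ.carrier := by
  rw [smul_subset_iff, ofSimple_subset_iff, smul_carrier, LinearEquiv.image_eq_preimage_symm,
    Set.mem_preimage, map_inv]
  rfl

end RootSubsystem

namespace JuyumayaMap

variable {B C : Type*} {M : CoxeterMatrix B} {N : CoxeterMatrix C} {W U : Type*} [Group W]
  [Group U] {cs : CoxeterSystem M W} {ct : CoxeterSystem N U} (J : JuyumayaMap cs ct)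

theorem closure_tiesAction_tie' :
    Submonoid.closure (Set.range fun p : W × B => J.tiesAction p.1 (J.tie' p.2)) = ⊤ := by
  have hrange : (Set.range fun p : W × B => J.tiesAction p.1 (J.tie' p.2)) =
      ((↑) : J.ties → RootSubsystem ct) ⁻¹' {x | ∃ (w : W) (i : B), x = J.φ w • J.e i} := by
    ext x
    simp only [Set.mem_range, Prod.exists, Subtype.ext_iff, eq_comm (b := (x : RootSubsystem ct))]
    rfl
  rw [hrange]
  exact Submonoid.closure_closure_coe_preimage

theorem tiesHom_ext {X : Type*} [Monoid X] {f f' : J.ties →* X}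
    (h : ∀ w i, f (J.tiesAction w (J.tie' i)) = f' (J.tiesAction w (J.tie' i))) : f = f' :=
  MonoidHom.eq_of_eqOn_denseM J.closure_tiesAction_tie'
    (Set.forall_mem_range.mpr fun p => h p.1 p.2)

theorem exists_tiesHom {X : Type*} [Monoid X] {t : W → B → X}
    (hidem : ∀ w i, IsIdempotentElem (t w i)) (hcomm : ∀ w i w' i', Commute (t w i) (t w' i'))
    (Θ : X → RootSubsystem ct)
    (hΘ : ∀ w i x, (J.φ w • J.e i).carrier ⊆ (Θ x).carrier ↔ t w i * x = x) :
    ∃ F : J.ties →* X, ∀ w i, F (J.tiesAction w (J.tie' i)) = t w i := by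
  obtain ⟨F, hF⟩ := exists_monoidHom_of_absorbs (t := fun p : W × B => t p.1 p.2)
    (fun p => hidem p.1 p.2) (fun p p' => hcomm p.1 p.2 p'.1 p'.2) J.closure_tiesAction_tie'
    (fun y x => (y : RootSubsystem ct).carrier ⊆ (Θ x).carrier)
    (fun x => Set.empty_subset _) (fun _ _ _ => RootSubsystem.mul_subset_iff)
    (fun p => hΘ p.1 p.2)
  exact ⟨F, fun w i => hF (w, i)⟩

variable (R : Type*) [CommRing R]

theorem tiesAlgAction_of (w : W) (x : J.ties) :
    J.tiesAlgAction R w (MonoidAlgebra.of R _ x) = MonoidAlgebra.of R _ (J.tiesAction w x) := by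
  simp [tiesAlgAction]

theorem tiesAlgAction_tieElt_eq {i j : B} {w : W} (h : w * cs.simple i * w⁻¹ = cs.simple j) :
    J.tiesAlgAction R w (J.tieElt i) = J.tieElt j := by
  rw [tieElt, tiesAlgAction_of]
  exact congrArg _ (Subtype.ext (J.equivariant i j w h))

theorem tieElt_mul_tiesAlgAction_simple (i j : B) :
    J.tieElt i * J.tiesAlgAction R (cs.simple i) (J.tieElt j) = J.tieElt i * J.tieElt j := by
  rw [tieElt, tieElt, tiesAlgAction_of, ← map_mul, ← map_mul]
  refine congrArg _ (Subtype.ext ?_)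
  change J.e i * J.φ (cs.simple i) • J.e j = J.e i * J.e j
  simpa using (J.tie i j 1).symm

end JuyumayaMap

theorem artinProj_surjective {B : Type*} {M : CoxeterMatrix B} {W : Type*} [Group W]
    (cs : CoxeterSystem M W) : Function.Surjective (artinProj cs) := by
  rw [← MonoidHom.range_eq_top, eq_top_iff, ← cs.subgroup_closure_range_simple,
    Subgroup.closure_le]
  exact Set.range_subset_iff.mpr fun i => ⟨artinGen M i, artinProj_gen cs i⟩

namespace MarinDatum

variable {B : Type*} {M : CoxeterMatrix B} {W : Type*} [Group W] {cs : CoxeterSystem M W}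
  {k A : Type*} [CommRing k] [CommRing A] [Algebra k A] (D : MarinDatum cs k A)

theorem closure_range_braidGen : Subgroup.closure (Set.range D.braidGen) = ⊤ :=
  PresentedGroup.closure_range_of _

theorem proj_braidGen (i : B) : D.proj (D.braidGen i) = cs.simple i :=
  artinProj_gen cs i

/-- The structure map `c ↦ D.coeff c` as a homomorphism of algebras. -/
def coeffAlgHom : A →ₐ[k] D.MarinRing :=
  (RingQuot.mkAlgHom k D.Rel).comp
    { SkewMonoidAlgebra.singleOneRingHom (k := A) (G := D.Braid) with
      commutes' := fun r => by rw [SkewMonoidAlgebra.coe_algebraMap]; rfl }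

theorem coeffAlgHom_apply (c : A) : D.coeffAlgHom c = D.coeff c := rfl

/-- The image of the Artin group in the group of units of the Marin ring. -/
def braidUnit : D.Braid →* D.MarinRingˣ :=
  ((RingQuot.mkAlgHom k D.Rel : D.SemidirectProduct →* D.MarinRing).comp
    (SkewMonoidAlgebra.of A D.Braid)).toHomUnits

theorem coe_braidUnit (b : D.Braid) :
    (D.braidUnit b : D.MarinRing) =
      RingQuot.mkAlgHom k D.Rel (SkewMonoidAlgebra.single b 1) := rfl

theorem coe_braidUnit_braidGen (i : B) :
    (D.braidUnit (D.braidGen i) : D.MarinRing) = D.gen i := rfl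

theorem braidUnit_mul_coeff (b : D.Braid) (c : A) :
    D.braidUnit b * D.coeff c = D.coeff (b • c) * D.braidUnit b := by
  simp only [coe_braidUnit, coeff, scoeff, ← map_mul, SkewMonoidAlgebra.single_mul_single, one_mul,
    mul_one, one_smul]

theorem mkAlgHom_single (b : D.Braid) (c : A) :
    RingQuot.mkAlgHom k D.Rel (SkewMonoidAlgebra.single b c) = D.coeff c * D.braidUnit b := by
  rw [coe_braidUnit, coeff, scoeff, ← map_mul, SkewMonoidAlgebra.single_mul_single, one_mul,
    one_smul, mul_one]

theorem gen_mul_coeff (i : B) (c : A) :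
    D.gen i * D.coeff c = D.coeff (D.ρ (cs.simple i) c) * D.gen i := by
  rw [← coe_braidUnit_braidGen, braidUnit_mul_coeff, braid_smul, proj_braidGen]

theorem gen_sq (i : B) :
    D.gen i ^ 2 = D.coeff (D.a i) + D.coeff (1 - D.a i) * D.gen i := by
  have h := RingQuot.mkAlgHom_rel k (Rel.quadratic (D := D) i)
  rw [map_sub, map_sub, map_zero, map_pow, map_mul, sub_sub, sub_eq_zero] at h
  exact h

variable {D} {E : Type*} [Ring E] [Algebra k E]

theorem map_braidUnit_eq {f f' : D.MarinRing →ₐ[k] E} (hgen : ∀ i, f (D.gen i) = f' (D.gen i))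
    (b : D.Braid) : f (D.braidUnit b) = f' (D.braidUnit b) := by
  have h : (Units.map (f : D.MarinRing →* E)).comp D.braidUnit =
      (Units.map (f' : D.MarinRing →* E)).comp D.braidUnit :=
    PresentedGroup.ext fun i => Units.ext (hgen i)
  exact congrArg Units.val (DFunLike.congr_fun h b)

theorem algHom_ext_of_gen {f f' : D.MarinRing →ₐ[k] E} (hgen : ∀ i, f (D.gen i) = f' (D.gen i))
    (hcoeff : ∀ c, f (D.coeff c) = f' (D.coeff c)) : f = f' := by
  refine AlgHom.ext fun y => ?_
  obtain ⟨x, rfl⟩ := RingQuot.mkAlgHom_surjective k D.Rel y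
  induction x using SkewMonoidAlgebra.induction_on with
  | zero => simp only [map_zero]
  | single b c =>
    rw [mkAlgHom_single, map_mul, map_mul, hcoeff, map_braidUnit_eq hgen]
  | add x y hx hy => rw [map_add, map_add, map_add, hx, hy]

theorem map_smul_mul_of_gen {f : A →ₐ[k] E} {φ : D.Braid →* Eˣ}
    (hcomm : ∀ i c, φ (D.braidGen i) * f c = f (D.ρ (cs.simple i) c) * φ (D.braidGen i))
    (b : D.Braid) (c : A) : f (b • c) * φ b = φ b * f c := by
  have hb : b ∈ Subgroup.closure (Set.range D.braidGen) := D.closure_range_braidGen ▸ trivial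
  induction hb using Subgroup.closure_induction generalizing c with
  | mem b hb =>
    obtain ⟨i, rfl⟩ := hb
    rw [hcomm, braid_smul, proj_braidGen]
  | one => rw [one_smul, map_one, Units.val_one, one_mul, mul_one]
  | mul b b' _ _ h h' =>
    rw [mul_smul, map_mul, Units.val_mul, ← mul_assoc, h, mul_assoc, h', mul_assoc]
  | inv b _ h =>
    have h1 := h (b⁻¹ • c)
    rw [smul_inv_smul] at h1
    rw [map_inv, Units.eq_inv_mul_iff_mul_eq, ← mul_assoc, ← h1, Units.mul_inv_cancel_right]

/-- The homomorphism out of the semidirect product that extends `f` and `φ`. It suffices to check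
the relation between Artin group elements and coefficients on the generators. -/
def semidirectLift (f : A →ₐ[k] E) (φ : D.Braid →* Eˣ)
    (hcomm : ∀ i c, φ (D.braidGen i) * f c = f (D.ρ (cs.simple i) c) * φ (D.braidGen i)) :
    D.SemidirectProduct →ₐ[k] E :=
  SkewMonoidAlgebra.liftNCAlgHom f ((Units.coeHom E).comp φ) (map_smul_mul_of_gen hcomm _ _)

theorem semidirectLift_single {f : A →ₐ[k] E} {φ : D.Braid →* Eˣ}
    (hcomm : ∀ i c, φ (D.braidGen i) * f c = f (D.ρ (cs.simple i) c) * φ (D.braidGen i))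
    (b : D.Braid) (c : A) :
    semidirectLift f φ hcomm (SkewMonoidAlgebra.single b c) = f c * φ b :=
  SkewMonoidAlgebra.liftNC_single _ _ _ _

/-- The universal property of the Marin ring, as a map out of it. -/
def lift (f : A →ₐ[k] E) (φ : D.Braid →* Eˣ)
    (hcomm : ∀ i c, φ (D.braidGen i) * f c = f (D.ρ (cs.simple i) c) * φ (D.braidGen i))
    (hquad : ∀ i, (φ (D.braidGen i) : E) ^ 2 = f (D.a i) + f (1 - D.a i) * φ (D.braidGen i)) :
    D.MarinRing →ₐ[k] E :=
  RingQuot.liftAlgHom k ⟨semidirectLift f φ hcomm, by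
    rintro _ _ ⟨i⟩
    simp only [map_sub (semidirectLift _ _ _), map_zero, map_pow, map_mul, sgen, scoeff,
      semidirectLift_single, map_one, Units.val_one, one_mul, mul_one, hquad]
    abel⟩

variable {f : A →ₐ[k] E} {φ : D.Braid →* Eˣ}
  {hcomm : ∀ i c, φ (D.braidGen i) * f c = f (D.ρ (cs.simple i) c) * φ (D.braidGen i)}
  {hquad : ∀ i, (φ (D.braidGen i) : E) ^ 2 = f (D.a i) + f (1 - D.a i) * φ (D.braidGen i)}

theorem lift_gen (i : B) : lift f φ hcomm hquad (D.gen i) = φ (D.braidGen i) := by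
  rw [lift, gen, RingQuot.liftAlgHom_mkAlgHom_apply, sgen, semidirectLift_single, map_one,
    one_mul]

theorem lift_coeff (c : A) : lift f φ hcomm hquad (D.coeff c) = f c := by
  rw [lift, coeff, RingQuot.liftAlgHom_mkAlgHom_apply, scoeff, semidirectLift_single, map_one,
    Units.val_one, mul_one]

end MarinDatum

namespace JuyumayaMap

variable {B C : Type*} {M : CoxeterMatrix B} {N : CoxeterMatrix C} {W U : Type*} [Group W]
  [Group U] {cs : CoxeterSystem M W} {ct : CoxeterSystem N U} (J : JuyumayaMap cs ct)
  {R : Type*} [CommRing R] {u : B → Rˣ} {hu : ConjInvariant cs u}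

theorem braidUnit_mul_coeff_of (b : (J.marinDatum u hu).Braid) (x : J.ties) :
    (J.marinDatum u hu).braidUnit b * (J.marinDatum u hu).coeff (MonoidAlgebra.of R _ x) =
      (J.marinDatum u hu).coeff (MonoidAlgebra.of R _
        (J.tiesAction ((J.marinDatum u hu).proj b) x)) * (J.marinDatum u hu).braidUnit b := by
  rw [MarinDatum.braidUnit_mul_coeff, MarinDatum.braid_smul, ← tiesAlgAction_of]
  rfl

/-- The coefficients `w • e_i` are conjugates of the `e_i` under the Artin group. -/
theorem marinRing_algHom_ext {E : Type*} [Ring E] [Algebra R E]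
    {f f' : (J.marinDatum u hu).MarinRing →ₐ[R] E}
    (hgen : ∀ i, f ((J.marinDatum u hu).gen i) = f' ((J.marinDatum u hu).gen i))
    (htie : ∀ i, f ((J.marinDatum u hu).coeff (J.tieElt i)) =
      f' ((J.marinDatum u hu).coeff (J.tieElt i))) : f = f' := by
  let D := J.marinDatum u hu
  have hties : ((f.comp D.coeffAlgHom : _ →* E).comp (MonoidAlgebra.of R J.ties)) =
      ((f'.comp D.coeffAlgHom : _ →* E).comp (MonoidAlgebra.of R J.ties)) := by
    refine J.tiesHom_ext fun w i => ?_
    obtain ⟨b, rfl⟩ : ∃ b : D.Braid, D.proj b = w := artinProj_surjective cs w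
    have hconj := J.braidUnit_mul_coeff_of (hu := hu) b (J.tie' i)
    have hf := congrArg f hconj
    have hf' := congrArg f' hconj
    rw [map_mul, map_mul, ← tieElt, htie, MarinDatum.map_braidUnit_eq hgen] at hf
    rw [map_mul, map_mul, ← tieElt] at hf'
    exact ((D.braidUnit b).isUnit.map f').mul_right_cancel (hf.symm.trans hf')
  exact MarinDatum.algHom_ext_of_gen hgen
    (DFunLike.congr_fun (MonoidAlgebra.algHom_ext' hties (Subsingleton.elim _ _)))

end JuyumayaMap

section TypeA

variable {m : ℕ}

theorem idxDist_eq_one_iff {i j : Fin m} :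
    idxDist i j = 1 ↔ (i : ℕ) + 1 = j ∨ (j : ℕ) + 1 = i := by
  rw [idxDist, abs_eq one_pos.le]
  omega

theorem one_lt_idxDist_iff {i j : Fin m} :
    1 < idxDist i j ↔ (i : ℕ) + 1 < j ∨ (j : ℕ) + 1 < i := by
  rw [idxDist, lt_abs]
  omega

theorem idxDist_self_ne_one (i : Fin m) : idxDist i i ≠ 1 := by simp [idxDist]

theorem idxDist_comm (i j : Fin m) : idxDist i j = idxDist j i := abs_sub_comm _ _

theorem idxDist_trichotomy (i j : Fin m) : i = j ∨ idxDist i j = 1 ∨ 1 < idxDist i j := by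
  rw [idxDist_eq_one_iff, one_lt_idxDist_iff, Fin.ext_iff]
  omega

theorem typeA_apply_of_idxDist_eq_one {i j : Fin m} (h : idxDist i j = 1) :
    CoxeterMatrix.A m i j = 3 := by
  rw [idxDist_eq_one_iff] at h
  have hij : i ≠ j := by rintro rfl; omega
  simp [CoxeterMatrix.A, hij, h.symm]

theorem typeA_apply_of_one_lt_idxDist {i j : Fin m} (h : 1 < idxDist i j) :
    CoxeterMatrix.A m i j = 2 := by
  rw [one_lt_idxDist_iff] at h
  have hij : i ≠ j := by rintro rfl; omega
  have hadj : ¬((j : ℕ) + 1 = i ∨ (i : ℕ) + 1 = j) := by omega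
  simp [CoxeterMatrix.A, hij, hadj]

theorem prod_map_braidWord_of_one_lt_idxDist {H : Type*} [Monoid H] (f : Fin m → H) {i j : Fin m}
    (h : 1 < idxDist i j) :
    ((CoxeterSystem.braidWord (CoxeterMatrix.A m) i j).map f).prod = f i * f j := by
  simp [CoxeterSystem.braidWord, typeA_apply_of_one_lt_idxDist h, CoxeterSystem.alternatingWord]

theorem prod_map_braidWord_of_idxDist_eq_one {H : Type*} [Monoid H] (f : Fin m → H) {i j : Fin m}
    (h : idxDist i j = 1) :
    ((CoxeterSystem.braidWord (CoxeterMatrix.A m) i j).map f).prod = f j * f i * f j := by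
  simp [CoxeterSystem.braidWord, typeA_apply_of_idxDist_eq_one h, CoxeterSystem.alternatingWord,
    mul_assoc]

theorem prod_map_braidWord_comm {H : Type*} [Monoid H] {f : Fin m → H}
    (hcomm : ∀ i j, 1 < idxDist i j → f i * f j = f j * f i)
    (hbraid : ∀ i j, idxDist i j = 1 → f i * f j * f i = f j * f i * f j) (i j : Fin m) :
    ((CoxeterSystem.braidWord (CoxeterMatrix.A m) i j).map f).prod =
      ((CoxeterSystem.braidWord (CoxeterMatrix.A m) j i).map f).prod := by
  rcases idxDist_trichotomy i j with rfl | h | h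
  · rfl
  · rw [prod_map_braidWord_of_idxDist_eq_one f h,
      prod_map_braidWord_of_idxDist_eq_one f (idxDist_comm i j ▸ h), hbraid i j h]
  · rw [prod_map_braidWord_of_one_lt_idxDist f h,
      prod_map_braidWord_of_one_lt_idxDist f (idxDist_comm i j ▸ h), hcomm i j h]

theorem prod_map_artinGen_braidWord_comm {B : Type*} (M : CoxeterMatrix B) (i j : B) :
    ((CoxeterSystem.braidWord M i j).map (artinGen M)).prod =
      ((CoxeterSystem.braidWord M j i).map (artinGen M)).prod := by
  have h := PresentedGroup.one_of_mem (rels := {r : FreeGroup B | ∃ i j : B,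
    r = ((CoxeterSystem.braidWord M i j).map FreeGroup.of).prod *
      (((CoxeterSystem.braidWord M j i).map FreeGroup.of).prod)⁻¹}) ⟨i, j, rfl⟩
  rw [map_mul, map_inv, mul_inv_eq_one, map_list_prod, map_list_prod, List.map_map,
    List.map_map] at h
  exact h

theorem artinGen_mul_comm {i j : Fin m} (h : 1 < idxDist i j) :
    artinGen (CoxeterMatrix.A m) i * artinGen _ j = artinGen _ j * artinGen _ i := by
  rw [← prod_map_braidWord_of_one_lt_idxDist _ h, prod_map_artinGen_braidWord_comm,
    prod_map_braidWord_of_one_lt_idxDist _ (idxDist_comm i j ▸ h)]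

theorem artinGen_braid {i j : Fin m} (h : idxDist i j = 1) :
    artinGen (CoxeterMatrix.A m) i * artinGen _ j * artinGen _ i =
      artinGen _ j * artinGen _ i * artinGen _ j := by
  rw [← prod_map_braidWord_of_idxDist_eq_one _ h, prod_map_artinGen_braidWord_comm,
    prod_map_braidWord_of_idxDist_eq_one _ (idxDist_comm i j ▸ h)]

/-- The universal property of the braid group of type `A`: a family satisfying the braid relations
extends to a homomorphism. -/
def artinLift {H : Type*} [Group H] (f : Fin m → H)
    (hcomm : ∀ i j, 1 < idxDist i j → f i * f j = f j * f i)
    (hbraid : ∀ i j, idxDist i j = 1 → f i * f j * f i = f j * f i * f j) :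
    ArtinGroup (CoxeterMatrix.A m) →* H :=
  PresentedGroup.toGroup (f := f) <| by
    rintro r ⟨i, j, rfl⟩
    rw [map_mul, map_inv, mul_inv_eq_one, map_list_prod, map_list_prod, List.map_map, List.map_map]
    simpa [Function.comp_def] using prod_map_braidWord_comm hcomm hbraid i j

theorem artinLift_artinGen {H : Type*} [Group H] {f : Fin m → H}
    (hcomm : ∀ i j, 1 < idxDist i j → f i * f j = f j * f i)
    (hbraid : ∀ i j, idxDist i j = 1 → f i * f j * f i = f j * f i * f j) (i : Fin m) :
    artinLift f hcomm hbraid (artinGen _ i) = f i :=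
  PresentedGroup.toGroup.of _

theorem isLiftable_typeA {H : Type*} [Group H] {f : Fin m → H} (hsq : ∀ i, f i * f i = 1)
    (hcomm : ∀ i j, 1 < idxDist i j → f i * f j = f j * f i)
    (hbraid : ∀ i j, idxDist i j = 1 → f i * f j * f i = f j * f i * f j) :
    (CoxeterMatrix.A m).IsLiftable f := by
  intro i j
  have cancel (k : Fin m) (x : H) : f k * (f k * x) = x := by rw [← mul_assoc, hsq, one_mul]
  rcases idxDist_trichotomy i j with rfl | h | h
  · rw [CoxeterMatrix.diagonal, pow_one, hsq]
  · calc (f i * f j) ^ CoxeterMatrix.A m i j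
        = f i * f j * f i * (f j * f i * f j) := by
          rw [typeA_apply_of_idxDist_eq_one h]
          simp only [pow_succ, pow_zero, one_mul, mul_assoc]
      _ = 1 := by
          rw [hbraid i j h]
          simp only [mul_assoc, cancel, hsq]
  · rw [typeA_apply_of_one_lt_idxDist h, pow_two, mul_assoc, ← mul_assoc (f j), ← hcomm i j h,
      ← mul_assoc, ← mul_assoc, hsq, one_mul, hsq]

section Simple

variable {W : Type*} [Group W] (cs : CoxeterSystem (CoxeterMatrix.A m) W)

theorem simple_mul_comm {i j : Fin m} (h : 1 < idxDist i j) :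
    cs.simple i * cs.simple j = cs.simple j * cs.simple i := by
  simpa only [map_mul, artinProj_gen] using congrArg (artinProj cs) (artinGen_mul_comm h)

theorem simple_braid {i j : Fin m} (h : idxDist i j = 1) :
    cs.simple i * cs.simple j * cs.simple i = cs.simple j * cs.simple i * cs.simple j := by
  simpa only [map_mul, artinProj_gen] using congrArg (artinProj cs) (artinGen_braid h)

theorem simple_conj_of_idxDist_eq_one {i j : Fin m} (h : idxDist i j = 1) :
    (cs.simple i * cs.simple j) * cs.simple i * (cs.simple i * cs.simple j)⁻¹ = cs.simple j := by
  rw [simple_braid cs h]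
  group

theorem simple_conj_of_idxDist_ne_one {i j : Fin m} (h : idxDist i j ≠ 1) :
    cs.simple i * cs.simple j * (cs.simple i)⁻¹ = cs.simple j := by
  rcases idxDist_trichotomy i j with rfl | hij | hij
  · group
  · exact absurd hij h
  · rw [simple_mul_comm cs hij, mul_inv_cancel_right]

variable {cs} in
theorem ConjInvariant.exists_eq {X : Type*} [Nonempty X] {u : Fin m → X}
    (hu : ConjInvariant cs u) : ∃ q, ∀ i, u i = q := by
  rcases m with _ | m
  · exact ⟨Classical.arbitrary X, fun i => i.elim0⟩
  refine ⟨u 0, fun i => ?_⟩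
  induction i using Fin.induction with
  | zero => rfl
  | succ i ih =>
    have adjacent : idxDist i.castSucc i.succ = 1 := idxDist_eq_one_iff.mpr (Or.inl rfl)
    exact (hu _ _ _ (simple_conj_of_idxDist_eq_one cs adjacent)).symm.trans ih

end Simple

end TypeA

section SymmetricGroup

variable {m : ℕ}

theorem swap_braid {i j : Fin m} (h : idxDist i j = 1) :
    Equiv.swap i.castSucc i.succ * Equiv.swap j.castSucc j.succ * Equiv.swap i.castSucc i.succ =
      Equiv.swap j.castSucc j.succ * Equiv.swap i.castSucc i.succ *
        Equiv.swap j.castSucc j.succ := by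
  wlog hij : i.succ = j.castSucc generalizing i j
  · refine (this (idxDist_comm i j ▸ h) ?_).symm
    rw [idxDist_eq_one_iff] at h
    simp only [Fin.ext_iff, Fin.val_succ, Fin.val_castSucc] at hij ⊢
    omega
  have hij' : i.castSucc ≠ j.succ := (i.castSucc_lt_succ.trans (hij ▸ j.castSucc_lt_succ)).ne
  have hi := i.castSucc_lt_succ.ne
  have hj := j.castSucc_lt_succ.ne
  rw [hij] at hi ⊢
  rw [Equiv.swap_mul_swap_mul_swap hi hij', Equiv.swap_comm i.castSucc j.castSucc,
    Equiv.swap_comm j.castSucc j.succ, Equiv.swap_mul_swap_mul_swap hj.symm hij'.symm,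
    Equiv.swap_comm]

theorem swap_mul_comm {i j : Fin m} (h : 1 < idxDist i j) :
    Equiv.swap i.castSucc i.succ * Equiv.swap j.castSucc j.succ =
      Equiv.swap j.castSucc j.succ * Equiv.swap i.castSucc i.succ := by
  rw [one_lt_idxDist_iff] at h
  refine (Equiv.Perm.disjoint_swap_swap ?_).commute.eq
  simp only [List.nodup_cons, List.mem_cons, List.not_mem_nil, List.nodup_nil, Fin.ext_iff,
    Fin.val_castSucc, Fin.val_succ, or_false, not_false_eq_true, and_true]
  omega

variable {W : Type*} [Group W] (cs : CoxeterSystem (CoxeterMatrix.A m) W)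

/-- The permutation representation of a Coxeter group of type `A`, in which the simple reflection
`s_i` acts as the transposition of `i` and `i + 1`. -/
def permRep : W →* Equiv.Perm (Fin (m + 1)) :=
  cs.lift ⟨fun i => Equiv.swap i.castSucc i.succ,
    isLiftable_typeA (fun _ => Equiv.swap_mul_self _ _) (fun _ _ => swap_mul_comm)
      fun _ _ => swap_braid⟩

theorem permRep_simple (i : Fin m) : permRep cs (cs.simple i) = Equiv.swap i.castSucc i.succ :=
  cs.lift_apply_simple _ i

end SymmetricGroup

section Roots

variable {m : ℕ}

/-- The linear map realizing the root system of type `A` inside `ℝ^(m+1)`: it sends the simple root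
`α_i` to `ε_i - ε_(i+1)`. -/
def rootMap (m : ℕ) : GeomSpace (Fin m) →ₗ[ℝ] (Fin (m + 1) →₀ ℝ) :=
  Finsupp.linearCombination ℝ fun i => Finsupp.single i.castSucc 1 - Finsupp.single i.succ 1

theorem rootMap_simpleRoot (i : Fin m) :
    rootMap m (simpleRoot i) = Finsupp.single i.castSucc 1 - Finsupp.single i.succ 1 := by
  simp [rootMap, simpleRoot]

theorem mapDomain_swap {α K : Type*} [DecidableEq α] [Ring K] (a b : α) (v : α →₀ K) :
    v.mapDomain (Equiv.swap a b) =
      v - (v a - v b) • (Finsupp.single a 1 - Finsupp.single b 1) := by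
  ext x
  rw [← Finsupp.equivMapDomain_eq_mapDomain, Finsupp.equivMapDomain_apply, Equiv.symm_swap]
  rcases eq_or_ne x a with rfl | ha
  · rcases eq_or_ne x b with rfl | hb <;> simp [*]
  · rcases eq_or_ne x b with rfl | hb
    · simp [ha.symm]
    · simp [Equiv.swap_apply_of_ne_of_ne ha hb, ha, hb]

theorem two_mul_geomForm_simpleRoot (i : Fin m) (x : GeomSpace (Fin m)) :
    2 * geomForm (CoxeterMatrix.A m) (simpleRoot i) x =
      rootMap m x i.castSucc - rootMap m x i.succ := by
  suffices h : (2 : ℝ) • geomForm (CoxeterMatrix.A m) (simpleRoot i) =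
      (Finsupp.lapply i.castSucc - Finsupp.lapply i.succ) ∘ₗ rootMap m from LinearMap.congr_fun h x
  refine Finsupp.lhom_ext' fun j => LinearMap.ext_ring ?_
  change 2 * geomForm (CoxeterMatrix.A m) (simpleRoot i) (simpleRoot j) =
    rootMap m (simpleRoot j) i.castSucc - rootMap m (simpleRoot j) i.succ
  rw [rootMap_simpleRoot, geomForm_simple]
  rcases idxDist_trichotomy i j with rfl | h | h
  · rw [CoxeterMatrix.diagonal, Nat.cast_one, div_one, Real.cos_pi]
    norm_num [Finsupp.single_apply, Fin.ext_iff]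
  · rw [typeA_apply_of_idxDist_eq_one h, Nat.cast_ofNat, Real.cos_pi_div_three]
    rw [idxDist_eq_one_iff] at h
    simp only [Finsupp.sub_apply, Finsupp.single_apply, Fin.ext_iff, Fin.val_castSucc, Fin.val_succ]
    split_ifs <;> first | omega | norm_num
  · rw [typeA_apply_of_one_lt_idxDist h, Nat.cast_ofNat, Real.cos_pi_div_two]
    rw [one_lt_idxDist_iff] at h
    simp only [Finsupp.sub_apply, Finsupp.single_apply, Fin.ext_iff, Fin.val_castSucc, Fin.val_succ]
    split_ifs <;> first | omega | norm_num

theorem rootMap_simpleRefl (i : Fin m) (x : GeomSpace (Fin m)) :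
    rootMap m (simpleRefl (CoxeterMatrix.A m) i x) =
      (rootMap m x).mapDomain (Equiv.swap i.castSucc i.succ) := by
  rw [simpleRefl_apply, refl_apply, map_sub, map_smul, two_mul_geomForm_simpleRoot,
    rootMap_simpleRoot, mapDomain_swap]

variable {W : Type*} [Group W] (cs : CoxeterSystem (CoxeterMatrix.A m) W)

theorem rootMap_geomRep (w : W) (x : GeomSpace (Fin m)) :
    rootMap m (geomRep cs w x) = (rootMap m x).mapDomain (permRep cs w) := by
  induction w using cs.simple_induction generalizing x with
  | simple i => rw [geomRep_simple, rootMap_simpleRefl, permRep_simple]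
  | one => simp [Finsupp.mapDomain_id, Equiv.Perm.coe_one]
  | mul w w' h h' =>
    rw [map_mul, map_mul, LinearEquiv.mul_apply, h, h', Equiv.Perm.coe_mul, Finsupp.mapDomain_comp]

theorem rootMap_geomRep_simpleRoot (w : W) (i : Fin m) :
    rootMap m (geomRep cs w (simpleRoot i)) =
      Finsupp.single (permRep cs w i.castSucc) 1 - Finsupp.single (permRep cs w i.succ) 1 := by
  rw [rootMap_geomRep, rootMap_simpleRoot]
  exact (map_sub (Finsupp.lmapDomain ℝ ℝ (permRep cs w)) _ _).trans (by simp)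

namespace RootSubsystem

/-- The root subsystem attached to an equivalence relation on the coordinates: the roots whose
image `ε_a - ε_b` has `a` and `b` equivalent, that is, vanishes after equivalent coordinates are
identified. -/
def ofSetoid (r : Setoid (Fin (m + 1))) : RootSubsystem cs where
  carrier := roots cs ∩ (Finsupp.lmapDomain ℝ ℝ (Quotient.mk r) ∘ₗ rootMap m).ker
  subset_roots := Set.inter_subset_left
  refl_mem v hv x hx := by
    refine ⟨refl_mem_roots cs hv.1 hx.1, ?_⟩
    rw [refl_apply]
    exact sub_mem hx.2 (Submodule.smul_mem _ _ hv.2)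

theorem smul_ofSimple_subset_ofSetoid_iff (r : Setoid (Fin (m + 1))) (w : W) (i : Fin m) :
    (w • ofSimple cs i).carrier ⊆ (ofSetoid cs r).carrier ↔
      r (permRep cs w i.castSucc) (permRep cs w i.succ) := by
  have hroot : geomRep cs w (simpleRoot i) ∈ roots cs := ⟨w, i, rfl⟩
  rw [smul_ofSimple_subset_iff, ofSetoid, Set.mem_inter_iff, and_iff_right hroot, SetLike.mem_coe,
    LinearMap.mem_ker, LinearMap.comp_apply, rootMap_geomRep_simpleRoot, map_sub,
    Finsupp.lmapDomain_apply, Finsupp.lmapDomain_apply, Finsupp.mapDomain_single,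
    Finsupp.mapDomain_single, sub_eq_zero, Finsupp.single_left_inj one_ne_zero, Quotient.eq]

end RootSubsystem

end Roots

/-- The relations satisfied by the ties `e_j` and the conjugation action of the generators `g_i` of
the algebra of braids and ties, for elements `e_j` of a monoid `X` on which a group `G` acts. -/
structure IsTieSystem {G X : Type*} [Group G] [Monoid X] [MulDistribMulAction G X] {m : ℕ}
    (c : Fin m → G) (e : Fin m → X) : Prop where
  comm : ∀ i j, 1 < idxDist i j → c i * c j = c j * c i
  braid : ∀ i j, idxDist i j = 1 → c i * c j * c i = c j * c i * c j
  fix : ∀ i j, idxDist i j ≠ 1 → c i • e j = e j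
  move : ∀ i j, idxDist i j = 1 → c j • c i • e j = e i
  sq : ∀ i j, idxDist i j = 1 → c j • c j • e i = e i
  idem : ∀ i, IsIdempotentElem (e i)
  commute : ∀ i j, Commute (e i) (e j)
  mul_eq : ∀ i j, idxDist i j = 1 → e i * e j = e i * c j • e i

section Ties

variable {G X : Type*} [Group G] [Monoid X] [MulDistribMulAction G X] {m : ℕ}
  (c : Fin m → G) (e : Fin m → X)

/-- The tie joining `a` and `b` for `a < b`, obtained by transporting `e_a` with
`c_(b-1) ⋯ c_(a+1)`; it is `1` if `b ≤ a`. -/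
def arc (a : Fin (m + 1)) : Fin (m + 1) → X :=
  Fin.induction 1 fun k x => if a < k.castSucc then c k • x else if a = k.castSucc then e k else 1

theorem arc_castSucc_succ (k : Fin m) : arc c e k.castSucc k.succ = e k := by
  simp [arc]

theorem arc_succ {a : Fin (m + 1)} {k : Fin m} (h : a < k.castSucc) :
    arc c e a k.succ = c k • arc c e a k.castSucc := by
  simp [arc, h]

theorem arc_self (a : Fin (m + 1)) : arc c e a a = 1 := by
  cases a using Fin.cases with
  | zero => rfl
  | succ k => simp [arc, k.castSucc_lt_succ.not_gt, k.castSucc_lt_succ.ne']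

/-- The tie joining two elements of `{0, …, m}`; it is `1` if they are equal. -/
def tie (a b : Fin (m + 1)) : X := arc c e (min a b) (max a b)

theorem tie_comm (a b : Fin (m + 1)) : tie c e a b = tie c e b a := by
  rw [tie, tie, min_comm, max_comm]

theorem tie_self (a : Fin (m + 1)) : tie c e a a = 1 := by
  rw [tie, min_self, max_self, arc_self]

theorem tie_of_lt {a b : Fin (m + 1)} (h : a < b) : tie c e a b = arc c e a b := by
  rw [tie, min_eq_left h.le, max_eq_right h.le]

theorem tie_castSucc_succ (k : Fin m) : tie c e k.castSucc k.succ = e k := by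
  rw [tie_of_lt c e k.castSucc_lt_succ, arc_castSucc_succ]

theorem fin_lt_induction {a : Fin (m + 1)} {P : ∀ b, a < b → Prop}
    (base : ∀ (k : Fin m) (h : a = k.castSucc), P k.succ (h.trans_lt k.castSucc_lt_succ))
    (step : ∀ (k : Fin m) (h : a < k.castSucc), P k.castSucc h →
      P k.succ (h.trans k.castSucc_lt_succ)) (b : Fin (m + 1)) (hab : a < b) : P b hab := by
  induction b using Fin.induction with
  | zero => exact absurd hab (Fin.not_lt_zero a)
  | succ k ih =>
    rcases (Fin.le_castSucc_iff.mpr hab).eq_or_lt with h | h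
    · exact base k h
    · exact step k h (ih h)

theorem tie_castSucc_succ_of_succ_eq {i j : Fin m} (h : i.succ = j.castSucc) :
    tie c e i.castSucc j.succ = c j • e i := by
  have hij : i.castSucc < j.castSucc := h ▸ i.castSucc_lt_succ
  rw [tie_of_lt c e (hij.trans j.castSucc_lt_succ), arc_succ c e hij, ← h, arc_castSucc_succ]

variable {c e}

namespace IsTieSystem

variable (H : IsTieSystem c e)
include H

theorem smul_comm_of_lt {i j : Fin m} (hij : i.succ < j.castSucc) (x : X) :
    c i • c j • x = c j • c i • x := by
  rw [← mul_smul, H.comm i j (one_lt_idxDist_iff.mpr (Or.inl hij)), mul_smul]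

theorem smul_arc_of_outside {k : Fin m} {a b : Fin (m + 1)} (hab : a < b)
    (h : k.succ < a ∨ b < k.castSucc) : c k • arc c e a b = arc c e a b := by
  induction b, hab using fin_lt_induction with
  | base j ha =>
    rw [ha, arc_castSucc_succ]
    refine H.fix k j fun hkj => ?_
    rw [idxDist_eq_one_iff] at hkj
    subst ha
    simp only [Fin.lt_def, Fin.val_succ, Fin.val_castSucc] at h
    omega
  | step j ha ih =>
    rw [arc_succ c e ha]
    rcases h with h | h
    · rw [H.smul_comm_of_lt (h.trans ha), ih (Or.inl h)]
    · rw [← H.smul_comm_of_lt h, ih (Or.inr (j.castSucc_lt_succ.trans h))]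

theorem smul_arc_of_inside {k : Fin m} {a b : Fin (m + 1)} (hak : a < k.castSucc)
    (hkb : k.succ < b) : c k • arc c e a b = arc c e a b := by
  induction b, hkb using fin_lt_induction with
  | base j hj =>
    have hkj : idxDist k j = 1 := idxDist_eq_one_iff.mpr (Or.inl (congrArg Fin.val hj))
    have hjk : k.castSucc < j.castSucc := hj ▸ k.castSucc_lt_succ
    have harc : arc c e a j.succ = c j • c k • arc c e a k.castSucc := by
      rw [arc_succ c e (hak.trans hjk), ← hj, arc_succ c e hak]
    calc c k • arc c e a j.succ = (c k * c j * c k) • arc c e a k.castSucc := by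
          rw [harc, mul_smul, mul_smul]
      _ = c j • c k • c j • arc c e a k.castSucc := by
          rw [H.braid k j hkj, mul_smul, mul_smul]
      _ = arc c e a j.succ := by rw [H.smul_arc_of_outside hak (Or.inr hjk), harc]
  | step j hj ih =>
    rw [arc_succ c e ((hak.trans k.castSucc_lt_succ).trans hj), H.smul_comm_of_lt hj, ih]

theorem smul_arc_castSucc {k : Fin m} {b : Fin (m + 1)} (hkb : k.succ < b) :
    c k • arc c e k.castSucc b = arc c e k.succ b := by
  induction b, hkb using fin_lt_induction with
  | base j hj =>
    have hjk : idxDist j k = 1 := idxDist_eq_one_iff.mpr (Or.inr (congrArg Fin.val hj))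
    rw [arc_succ c e (hj ▸ k.castSucc_lt_succ), ← hj, arc_castSucc_succ, hj, arc_castSucc_succ,
      H.move j k hjk]
  | step j hj ih =>
    rw [arc_succ c e (k.castSucc_lt_succ.trans hj), arc_succ c e hj, H.smul_comm_of_lt hj, ih]

theorem smul_arc_succ {k : Fin m} {b : Fin (m + 1)} (hkb : k.succ < b) :
    c k • arc c e k.succ b = arc c e k.castSucc b := by
  induction b, hkb using fin_lt_induction with
  | base j hj =>
    have hkj : idxDist k j = 1 := idxDist_eq_one_iff.mpr (Or.inl (congrArg Fin.val hj))
    rw [hj, arc_castSucc_succ, arc_succ c e (hj ▸ k.castSucc_lt_succ), ← hj, arc_castSucc_succ]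
    exact MulAction.injective (c j) ((H.move k j hkj).trans (H.sq k j hkj).symm)
  | step j hj ih =>
    rw [arc_succ c e (k.castSucc_lt_succ.trans hj), arc_succ c e hj, H.smul_comm_of_lt hj, ih]

theorem smul_smul_arc_castSucc {k : Fin m} {a : Fin (m + 1)} (hak : a < k.castSucc) :
    c k • c k • arc c e a k.castSucc = arc c e a k.castSucc := by
  induction a using Fin.reverseInduction with
  | last => exact absurd hak k.castSucc.le_last.not_gt
  | cast i ih =>
    rcases (Fin.castSucc_lt_iff_succ_le.mp hak).eq_or_lt with h | h
    · rw [← h, arc_castSucc_succ]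
      exact H.sq i k (idxDist_eq_one_iff.mpr (Or.inl (congrArg Fin.val h)))
    · rw [← H.smul_arc_succ h, ← H.smul_comm_of_lt h, ← H.smul_comm_of_lt h, ih h]

theorem smul_tie (k : Fin m) (a b : Fin (m + 1)) :
    c k • tie c e a b =
      tie c e (Equiv.swap k.castSucc k.succ a) (Equiv.swap k.castSucc k.succ b) := by
  wlog hab : a < b generalizing a b
  · rcases (not_lt.mp hab).eq_or_lt with rfl | h
    · rw [tie_self, tie_self, smul_one]
    · rw [tie_comm, this b a h, tie_comm]
  rw [tie_of_lt c e hab]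
  have fixed {x : Fin (m + 1)} (h : x ≠ k.castSucc) (h' : x ≠ k.succ) :
      Equiv.swap k.castSucc k.succ x = x := Equiv.swap_apply_of_ne_of_ne h h'
  rcases eq_or_ne b k.castSucc with rfl | hb
  · have ha : a < k.succ := hab.trans k.castSucc_lt_succ
    rw [fixed hab.ne ha.ne, Equiv.swap_apply_left, tie_of_lt c e ha, arc_succ c e hab]
  rcases eq_or_ne b k.succ with rfl | hb'
  · rcases (Fin.le_castSucc_iff.mpr hab).eq_or_lt with rfl | ha
    · rw [Equiv.swap_apply_left, Equiv.swap_apply_right, tie_comm, tie_castSucc_succ,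
        arc_castSucc_succ, H.fix k k (idxDist_self_ne_one k)]
    · rw [fixed ha.ne hab.ne, Equiv.swap_apply_right, tie_of_lt c e ha, arc_succ c e ha,
        H.smul_smul_arc_castSucc ha]
  rw [fixed hb hb']
  rcases eq_or_ne a k.castSucc with rfl | ha
  · have hkb : k.succ < b := (Fin.castSucc_lt_iff_succ_le.mp hab).lt_of_ne' hb'
    rw [Equiv.swap_apply_left, tie_of_lt c e hkb, H.smul_arc_castSucc hkb]
  rcases eq_or_ne a k.succ with rfl | ha'
  · rw [Equiv.swap_apply_right, tie_of_lt c e (k.castSucc_lt_succ.trans hab), H.smul_arc_succ hab]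
  rw [fixed ha ha', tie_of_lt c e hab]
  by_cases h : a < k.castSucc ∧ k.succ < b
  · exact H.smul_arc_of_inside h.1 h.2
  · refine H.smul_arc_of_outside hab ?_
    simp only [Fin.lt_def, Fin.ext_iff, Fin.val_succ, Fin.val_castSucc, ne_eq] at *
    omega

theorem exists_smul_tie (σ : Equiv.Perm (Fin (m + 1))) :
    ∃ γ : G, ∀ a b, γ • tie c e a b = tie c e (σ a) (σ b) := by
  have hσ : σ ∈ Submonoid.closure (Set.range fun k : Fin m => Equiv.swap k.castSucc k.succ) := by
    rw [Equiv.Perm.mclosure_swap_castSucc_succ]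
    exact Submonoid.mem_top σ
  induction hσ using Submonoid.closure_induction with
  | mem _ hx =>
    obtain ⟨k, rfl⟩ := hx
    exact ⟨c k, H.smul_tie k⟩
  | one => exact ⟨1, fun a b => one_smul G _⟩
  | mul _ _ _ _ hx hy =>
    obtain ⟨γ, hγ⟩ := hx
    obtain ⟨δ, hδ⟩ := hy
    exact ⟨γ * δ, fun a b => by rw [mul_smul, hδ, hγ]; rfl⟩

end IsTieSystem

theorem exists_perm_castLE_eq {n k : ℕ} {x : Fin k → Fin n} (hx : Function.Injective x)
    (hk : k ≤ n) : ∃ σ : Equiv.Perm (Fin n), ∀ i, σ (Fin.castLE hk i) = x i := by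
  have := Equiv.Perm.isMultiplyPretransitive (Fin n) k
  obtain ⟨σ, hσ⟩ := MulAction.isMultiplyPretransitive_iff.mp this (Fin.castLEEmb hk) ⟨x, hx⟩
  exact ⟨σ, DFunLike.congr_fun hσ⟩

namespace IsTieSystem

variable (H : IsTieSystem c e)
include H

theorem exists_smul_tie_castLE {k : ℕ} {x : Fin (k + 1) → Fin (m + 1)}
    (hx : Function.Injective x) (hk : k + 1 ≤ m + 1) :
    ∃ γ : G, ∀ i j, γ • tie c e (Fin.castLE hk i) (Fin.castLE hk j) = tie c e (x i) (x j) := by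
  obtain ⟨σ, hσ⟩ := exists_perm_castLE_eq hx hk
  obtain ⟨γ, hγ⟩ := H.exists_smul_tie σ
  exact ⟨γ, fun i j => by rw [hγ, hσ, hσ]⟩

theorem tie_mul_tie {a b d : Fin (m + 1)} (hab : a ≠ b) (hbd : b ≠ d) (had : a ≠ d) :
    tie c e a b * tie c e b d = tie c e a b * tie c e a d := by
  have hx : Function.Injective ![a, b, d] := by
    intro i j h
    fin_cases i <;> fin_cases j <;> simp_all [eq_comm]
  have hk : 3 ≤ m + 1 := by simpa using Fintype.card_le_of_injective _ hx
  obtain ⟨γ, hγ⟩ := H.exists_smul_tie_castLE hx hk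
  have consecutive {i j : Fin m} (h : i.succ = j.castSucc) :
      tie c e i.castSucc i.succ * tie c e j.castSucc j.succ =
        tie c e i.castSucc i.succ * tie c e i.castSucc j.succ := by
    rw [tie_castSucc_succ, tie_castSucc_succ, tie_castSucc_succ_of_succ_eq c e h]
    exact H.mul_eq i j (idxDist_eq_one_iff.mpr (Or.inl (congrArg Fin.val h)))
  have h := congrArg (γ • ·) (consecutive (i := ⟨0, by omega⟩) (j := ⟨1, by omega⟩) rfl)
  simp only [smul_mul'] at h
  exact (congrArg₂ (· * ·) (hγ 0 1) (hγ 1 2)).symm.trans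
    (h.trans (congrArg₂ (· * ·) (hγ 0 1) (hγ 0 2)))

theorem commute_tie_of_injective {k : ℕ} {x : Fin (k + 1) → Fin (m + 1)}
    (hx : Function.Injective x) (i j : Fin k) :
    Commute (tie c e (x i.castSucc) (x i.succ)) (tie c e (x j.castSucc) (x j.succ)) := by
  have hk : k + 1 ≤ m + 1 := by simpa using Fintype.card_le_of_injective _ hx
  obtain ⟨γ, hγ⟩ := H.exists_smul_tie_castLE hx hk
  have transport (l : Fin k) :
      tie c e (x l.castSucc) (x l.succ) = γ • e (l.castLE (Nat.le_of_succ_le_succ hk)) := by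
    rw [← hγ, ← tie_castSucc_succ c e]
    rfl
  rw [transport, transport]
  exact (H.commute _ _).map (MulDistribMulAction.toMonoidHom X γ)

theorem commute_tie (a b x y : Fin (m + 1)) : Commute (tie c e a b) (tie c e x y) := by
  have shared {a b d : Fin (m + 1)} (hab : a ≠ b) (hbd : b ≠ d) :
      Commute (tie c e a b) (tie c e b d) := by
    rcases eq_or_ne a d with rfl | had
    · rw [tie_comm]
    refine H.commute_tie_of_injective (x := ![a, b, d]) (fun i j h => ?_) 0 1
    fin_cases i <;> fin_cases j <;> simp_all [eq_comm]
  rcases eq_or_ne a b with rfl | hab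
  · rw [tie_self]
    exact Commute.one_left _
  rcases eq_or_ne x y with rfl | hxy
  · rw [tie_self]
    exact Commute.one_right _
  rcases eq_or_ne b x with rfl | hbx
  · exact shared hab hxy
  rcases eq_or_ne b y with rfl | hby
  · rw [tie_comm c e x]
    exact shared hab hxy.symm
  rcases eq_or_ne a x with rfl | hax
  · rw [tie_comm c e a b]
    exact shared hab.symm hxy
  rcases eq_or_ne a y with rfl | hay
  · rw [tie_comm c e a b, tie_comm c e x]
    exact shared hab.symm hxy.symm
  refine H.commute_tie_of_injective (x := ![a, b, x, y]) (fun i j h => ?_) 0 2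
  fin_cases i <;> fin_cases j <;> simp_all [eq_comm]

/-- The ties absorbed by a fixed element `x`, as an equivalence relation on `{0, …, m}`. -/
def absorbSetoid (x : X) : Setoid (Fin (m + 1)) where
  r a b := tie c e a b * x = x
  iseqv :=
    { refl a := by rw [tie_self, one_mul]
      symm h := by rwa [tie_comm]
      trans {a b d} hab hbd := by
        rcases eq_or_ne a b with rfl | hab'
        · exact hbd
        rcases eq_or_ne b d with rfl | hbd'
        · exact hab
        rcases eq_or_ne a d with rfl | had
        · rw [tie_self, one_mul]
        calc tie c e a d * x = tie c e a b * tie c e a d * x := by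
              rw [(H.commute_tie a b a d).eq, mul_assoc, hab]
          _ = x := by rw [← H.tie_mul_tie hab' hbd' had, mul_assoc, hbd, hab] }

variable {W : Type*} [Group W] (cs : CoxeterSystem (CoxeterMatrix.A m) W)

theorem exists_tiesHom :
    ∃ F : (JuyumayaMap.identity cs).ties →* X,
      (∀ i, F ((JuyumayaMap.identity cs).tie' i) = e i) ∧
      ∀ i x, F ((JuyumayaMap.identity cs).tiesAction (cs.simple i) x) = c i • F x := by
  let t (w : W) (i : Fin m) : X := tie c e (permRep cs w i.castSucc) (permRep cs w i.succ)
  have hidem (w : W) (i : Fin m) : IsIdempotentElem (t w i) := by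
    obtain ⟨γ, hγ⟩ := H.exists_smul_tie (permRep cs w)
    change IsIdempotentElem (tie c e _ _)
    rw [← hγ, tie_castSucc_succ]
    exact (H.idem i).map (MulDistribMulAction.toMonoidHom X γ)
  obtain ⟨F, hF⟩ := (JuyumayaMap.identity cs).exists_tiesHom (t := t) hidem
    (fun _ _ _ _ => H.commute_tie _ _ _ _) (fun x => RootSubsystem.ofSetoid cs (H.absorbSetoid x))
    (fun w i x => RootSubsystem.smul_ofSimple_subset_ofSetoid_iff cs _ w i)
  have hF_tie (i : Fin m) : F ((JuyumayaMap.identity cs).tie' i) = e i := by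
    simpa [t, tie_castSucc_succ] using hF 1 i
  refine ⟨F, hF_tie, fun k x => ?_⟩
  have hact : F.comp ((JuyumayaMap.identity cs).tiesAction (cs.simple k)).toMonoidHom =
      (MulDistribMulAction.toMonoidHom X (c k)).comp F := by
    refine JuyumayaMap.tiesHom_ext _ fun w i => ?_
    change F ((JuyumayaMap.identity cs).tiesAction (cs.simple k)
      ((JuyumayaMap.identity cs).tiesAction w _)) = c k • F _
    rw [← MulAut.mul_apply, ← map_mul, hF, hF, H.smul_tie, ← permRep_simple cs]
    simp only [t, map_mul, Equiv.Perm.mul_apply]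
  exact DFunLike.congr_fun hact x

end IsTieSystem

end Ties

theorem one_add_smul_mul_one_add_smul {R E : Type*} [CommRing R] [Ring E] [Algebra R E] {q r : R}
    (hqr : q * r = 1) {p : E} (hp : IsIdempotentElem p) :
    (1 + (q - 1) • p) * (1 + (r - 1) • p) = 1 := by
  rw [mul_add, mul_one, add_mul, one_mul, smul_mul_smul_comm, hp.eq]
  match_scalars
  · rfl
  · linear_combination hqr

theorem isUnit_one_add_smul {R E : Type*} [CommRing R] [Ring E] [Algebra R E] (q : Rˣ) {p : E}
    (hp : IsIdempotentElem p) : IsUnit (1 + ((q : R) - 1) • p) :=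
  ⟨⟨_, 1 + (((q⁻¹ : Rˣ) : R) - 1) • p, one_add_smul_mul_one_add_smul q.mul_inv hp,
    one_add_smul_mul_one_add_smul q.inv_mul hp⟩, rfl⟩

theorem add_one_sub_mul_eq_one_add_smul {R E : Type*} [CommRing R] [Ring E] [Algebra R E] (r : R)
    (p g : E) : (1 + r • p) + (1 - (1 + r • p)) * g = 1 + r • (p * (1 - g)) := by
  rw [sub_add_cancel_left, neg_mul, smul_mul_assoc, mul_sub, mul_one, smul_sub]
  abel

/-- Families `γ_i`, `τ_i` in an algebra that satisfy the defining relations of the generators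
`g_i`, `e_i` of the algebra of braids and ties with parameter `q`. -/
structure IsBTFamily {R E : Type*} [CommRing R] [Ring E] [Algebra R E] {m : ℕ} (q : R)
    (γ τ : Fin m → E) : Prop where
  gg : ∀ i j, 1 < idxDist i j → γ i * γ j = γ j * γ i
  ggg : ∀ i j, idxDist i j = 1 → γ i * γ j * γ i = γ j * γ i * γ j
  quadratic : ∀ i, γ i ^ 2 = 1 + (q - 1) • (τ i * (1 - γ i))
  ge : ∀ i j, idxDist i j ≠ 1 → γ i * τ j = τ j * γ i
  gge : ∀ i j, idxDist i j = 1 → γ j * γ i * τ j = τ i * γ j * γ i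
  ee : ∀ i j, τ i * τ j = τ j * τ i
  idem : ∀ i, τ i ^ 2 = τ i
  eeg : ∀ i j, idxDist i j = 1 → τ i * τ j * γ j = τ i * γ j * τ i
  ege : ∀ i j, idxDist i j = 1 → τ i * γ j * τ i = γ j * τ i * τ j

namespace IsBTFamily

variable {R E : Type*} [CommRing R] [Ring E] [Algebra R E] {m : ℕ}

section Relations

variable {q : R} {γ τ : Fin m → E} (H : IsBTFamily q γ τ)
include H

theorem isIdempotentElem (i : Fin m) : IsIdempotentElem (τ i) := by
  rw [IsIdempotentElem, ← pow_two, H.idem]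

theorem g_mul_g_add (i : Fin m) : γ i * (γ i + (q - 1) • τ i) = 1 + (q - 1) • τ i := by
  rw [mul_add, mul_smul_comm, H.ge i i (idxDist_self_ne_one i), ← pow_two, H.quadratic, mul_sub,
    mul_one, smul_sub, add_assoc, sub_add_cancel]

theorem commute_e_mul_g_e {i j : Fin m} (h : idxDist i j = 1) : Commute (τ j * γ j) (τ i) :=
  have hj : γ j * τ j = τ j * γ j := H.ge j j (idxDist_self_ne_one j)
  calc τ j * γ j * τ i = γ j * τ i * τ j := by rw [← hj, mul_assoc, H.ee j i, mul_assoc]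
    _ = τ i * τ j * γ j := by rw [← H.ege i j h, H.eeg i j h]
    _ = τ i * (τ j * γ j) := mul_assoc _ _ _

theorem commute_g_sq_e {i j : Fin m} (h : idxDist i j = 1) : Commute (γ j ^ 2) (τ i) := by
  rw [H.quadratic, mul_sub, mul_one]
  exact (Commute.one_left _).add_left
    ((Commute.sub_left (H.ee j i) (H.commute_e_mul_g_e h)).smul_left _)

end Relations

theorem isUnit_g {q : Rˣ} {γ τ : Fin m → E} (H : IsBTFamily (q : R) γ τ) (i : Fin m) :
    IsUnit (γ i) := by
  have hunit : IsUnit (γ i * (γ i + ((q : R) - 1) • τ i)) :=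
    H.g_mul_g_add i ▸ isUnit_one_add_smul q (H.isIdempotentElem i)
  have hcomm : Commute (γ i) (τ i) := H.ge i i (idxDist_self_ne_one i)
  exact (((Commute.refl _).add_right (hcomm.smul_right _)).isUnit_mul_iff.mp hunit).1

theorem isTieSystem {q : R} {v : Fin m → Eˣ} {τ : Fin m → E}
    (H : IsBTFamily q (fun i => (v i : E)) τ) :
    IsTieSystem (fun i => ConjAct.toConjAct (v i)) τ := by
  have conj_eq_iff (x : Eˣ) (y z : E) : ConjAct.toConjAct x • y = z ↔ x * y = z * x := by
    rw [ConjAct.units_smul_def, ConjAct.ofConjAct_toConjAct, Units.mul_inv_eq_iff_eq_mul]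
  exact {
    comm := fun i j h => congrArg ConjAct.toConjAct (Units.ext (H.gg i j h))
    braid := fun i j h => congrArg ConjAct.toConjAct (Units.ext (H.ggg i j h))
    fix := fun i j h => (conj_eq_iff _ _ _).mpr (H.ge i j h)
    move := fun i j h => by
      rw [← mul_smul, ← map_mul, conj_eq_iff, Units.val_mul, ← mul_assoc]
      exact H.gge i j h
    sq := fun i j h => by
      rw [← mul_smul, ← map_mul, conj_eq_iff, Units.val_mul, ← pow_two]
      exact H.commute_g_sq_e h
    idem := H.isIdempotentElem
    commute := H.ee
    mul_eq := fun i j h => by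
      rw [ConjAct.units_smul_def, ConjAct.ofConjAct_toConjAct, ← mul_assoc,
        Units.eq_mul_inv_iff_mul_eq, ← mul_assoc]
      exact H.eeg i j h }

end IsBTFamily

namespace BTAlgebra

variable {R : Type*} [CommRing R] {n : ℕ} {q : R}

theorem isBTFamily (q : R) : IsBTFamily q (g (n := n) q) (e q) where
  gg i j h := by simpa only [map_mul, g] using RingQuot.mkAlgHom_rel R (BTRel.gg i j h)
  ggg i j h := by simpa only [map_mul, g] using RingQuot.mkAlgHom_rel R (BTRel.ggg i j h)
  quadratic i := by
    simpa only [map_mul, map_pow, map_add, map_sub, map_smul, map_one, g, e] using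
      RingQuot.mkAlgHom_rel R (BTRel.quadratic (q := q) i)
  ge i j h := by simpa only [map_mul, g, e] using RingQuot.mkAlgHom_rel R (BTRel.ge i j h)
  gge i j h := by simpa only [map_mul, g, e] using RingQuot.mkAlgHom_rel R (BTRel.gge i j h)
  ee i j := by simpa only [map_mul, e] using RingQuot.mkAlgHom_rel R (BTRel.ee i j)
  idem i := by simpa only [map_pow, e] using RingQuot.mkAlgHom_rel R (BTRel.idem i)
  eeg i j h := by simpa only [map_mul, g, e] using RingQuot.mkAlgHom_rel R (BTRel.eeg i j h)
  ege i j h := by simpa only [map_mul, g, e] using RingQuot.mkAlgHom_rel R (BTRel.ege i j h)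

variable {E : Type*} [Ring E] [Algebra R E] {γ τ : Fin (n - 1) → E}

/-- The homomorphism out of the free algebra with `fg R n i ↦ γ i` and `fe R n i ↦ τ i`. -/
def freeLift (γ τ : Fin (n - 1) → E) : FreeAlgebra R (BTGen n) →ₐ[R] E :=
  FreeAlgebra.lift R fun
    | .g i => γ i
    | .e i => τ i

theorem freeLift_fg (i : Fin (n - 1)) : freeLift γ τ (fg R n i) = γ i :=
  FreeAlgebra.lift_ι_apply _ _

theorem freeLift_fe (i : Fin (n - 1)) : freeLift γ τ (fe R n i) = τ i :=
  FreeAlgebra.lift_ι_apply _ _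

theorem freeLift_eq_of_rel (H : IsBTFamily q γ τ) {x y : FreeAlgebra R (BTGen n)}
    (h : BTRel R n q x y) : freeLift γ τ x = freeLift γ τ y := by
  cases h <;>
    simp only [map_mul, map_pow, map_add, map_sub, map_smul, map_one, freeLift_fg, freeLift_fe]
  case gg h => exact H.gg _ _ h
  case ggg h => exact H.ggg _ _ h
  case quadratic => exact H.quadratic _
  case ge h => exact H.ge _ _ h
  case gge h => exact H.gge _ _ h
  case ee => exact H.ee _ _
  case idem => exact H.idem _
  case eeg h => exact H.eeg _ _ h
  case ege h => exact H.ege _ _ h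

/-- The universal property of the algebra of braids and ties, as a map out of it. -/
def lift (H : IsBTFamily q γ τ) : BTAlgebra R n q →ₐ[R] E :=
  RingQuot.liftAlgHom R ⟨freeLift γ τ, fun _ _ => freeLift_eq_of_rel H⟩

theorem lift_g (H : IsBTFamily q γ τ) (i : Fin (n - 1)) : lift H (g q i) = γ i := by
  rw [lift, g, RingQuot.liftAlgHom_mkAlgHom_apply, freeLift_fg]

theorem lift_e (H : IsBTFamily q γ τ) (i : Fin (n - 1)) : lift H (e q i) = τ i := by
  rw [lift, e, RingQuot.liftAlgHom_mkAlgHom_apply, freeLift_fe]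

theorem algHom_ext {f f' : BTAlgebra R n q →ₐ[R] E} (hg : ∀ i, f (g q i) = f' (g q i))
    (he : ∀ i, f (e q i) = f' (e q i)) : f = f' := by
  refine RingQuot.ringQuot_ext' _ _ _ (FreeAlgebra.hom_ext (funext fun x => ?_))
  cases x with
  | g i => exact hg i
  | e i => exact he i

end BTAlgebra

namespace MarinDatum

variable {m : ℕ} {W : Type*} [Group W] {cs : CoxeterSystem (CoxeterMatrix.A m) W}
  {k A : Type*} [CommRing k] [CommRing A] [Algebra k A] (D : MarinDatum cs k A)

theorem gen_mul_comm {i j : Fin m} (h : 1 < idxDist i j) :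
    D.gen i * D.gen j = D.gen j * D.gen i := by
  have hbraid : D.braidGen i * D.braidGen j = D.braidGen j * D.braidGen i := artinGen_mul_comm h
  simpa only [map_mul, Units.val_mul, coe_braidUnit_braidGen] using
    congrArg (fun b => (D.braidUnit b : D.MarinRing)) hbraid

theorem gen_braid {i j : Fin m} (h : idxDist i j = 1) :
    D.gen i * D.gen j * D.gen i = D.gen j * D.gen i * D.gen j := by
  have hbraid : D.braidGen i * D.braidGen j * D.braidGen i =
      D.braidGen j * D.braidGen i * D.braidGen j := artinGen_braid h
  simpa only [map_mul, Units.val_mul, coe_braidUnit_braidGen] using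
    congrArg (fun b => (D.braidUnit b : D.MarinRing)) hbraid

end MarinDatum

namespace JuyumayaMap

theorem mul_lift_eq_lift_tiesAlgAction_mul {B C : Type*} {M : CoxeterMatrix B} {N : CoxeterMatrix C}
    {W U : Type*} [Group W] [Group U] {cs : CoxeterSystem M W} {ct : CoxeterSystem N U}
    (J : JuyumayaMap cs ct) {R E : Type*} [CommRing R] [Ring E] [Algebra R E] {F : J.ties →* E}
    {v : E} {w : W} (h : ∀ x, v * F x = F (J.tiesAction w x) * v) (c : MonoidAlgebra R J.ties) :
    v * MonoidAlgebra.lift R E J.ties F c =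
      MonoidAlgebra.lift R E J.ties F (J.tiesAlgAction R w c) * v := by
  induction c using MonoidAlgebra.induction_on with
  | of x => rw [tiesAlgAction_of, MonoidAlgebra.lift_of, MonoidAlgebra.lift_of, h]
  | add x y hx hy => simp only [map_add, add_mul, mul_add, hx, hy]
  | smul r x hx => simp only [map_smul, smul_mul_assoc, mul_smul_comm, hx]

variable {R : Type*} [CommRing R] {m : ℕ} {W : Type*} [Group W]
  (cs : CoxeterSystem (CoxeterMatrix.A m) W)

theorem tiesAlgAction_simple_of_idxDist_ne_one {i j : Fin m} (h : idxDist i j ≠ 1) :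
    (identity cs).tiesAlgAction R (cs.simple i) ((identity cs).tieElt j) =
      (identity cs).tieElt j :=
  tiesAlgAction_tieElt_eq _ R (simple_conj_of_idxDist_ne_one cs h)

theorem tiesAlgAction_simple_comm {i j : Fin m} (h : idxDist i j = 1) :
    (identity cs).tiesAlgAction R (cs.simple i) ((identity cs).tieElt j) =
      (identity cs).tiesAlgAction R (cs.simple j) ((identity cs).tieElt i) := by
  rw [← tiesAlgAction_tieElt_eq _ R (simple_conj_of_idxDist_eq_one cs h), map_mul,
    AlgEquiv.mul_apply, ← AlgEquiv.mul_apply, ← map_mul, cs.simple_mul_simple_self, map_one,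
    AlgEquiv.one_apply]

theorem tieElt_mul_tiesAlgAction_self {i j : Fin m} (h : idxDist i j = 1) :
    (identity cs).tieElt i *
        (identity cs).tiesAlgAction R (cs.simple j) ((identity cs).tieElt i) =
      (identity cs).tieElt i * (identity cs).tieElt j := by
  rw [← tiesAlgAction_simple_comm cs h, tieElt_mul_tiesAlgAction_simple]

theorem tiesAlgAction_simple_mul (i j : Fin m) :
    (identity cs).tiesAlgAction R (cs.simple j)
        ((identity cs).tieElt i * (identity cs).tieElt j) =
      (identity cs).tieElt i * (identity cs).tieElt j := by
  rw [map_mul, tiesAlgAction_simple_of_idxDist_ne_one cs (idxDist_self_ne_one j), mul_comm,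
    tieElt_mul_tiesAlgAction_simple, mul_comm]

variable {u : Fin m → Rˣ} (hu : ConjInvariant cs u) {q : Rˣ} (hq : ∀ i, u i = q)
include hq

theorem coe_marinDatum_a (i : Fin m) :
    (((identity cs).marinDatum u hu).a i : MonoidAlgebra R (identity cs).ties) =
      1 + ((q : R) - 1) • (identity cs).tieElt i := by
  rw [← hq i]
  rfl

theorem isBTFamily_marinRing :
    IsBTFamily (q : R) ((identity cs).marinDatum u hu).gen
      fun i => ((identity cs).marinDatum u hu).coeff ((identity cs).tieElt i) := by
  have ha := coe_marinDatum_a cs hu hq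
  have hρ (w : W) : ((identity cs).marinDatum u hu).ρ w = (identity cs).tiesAlgAction R w := rfl
  generalize (identity cs).marinDatum u hu = D at ha hρ ⊢
  simp only [← D.coeffAlgHom_apply]
  have gen_mul (i : Fin m) (c) : D.gen i * D.coeffAlgHom c =
      D.coeffAlgHom ((identity cs).tiesAlgAction R (cs.simple i) c) * D.gen i := by
    rw [← hρ]
    exact D.gen_mul_coeff i c
  exact {
    gg := fun i j h => D.gen_mul_comm h
    ggg := fun i j h => D.gen_braid h
    quadratic := fun i => by
      rw [D.gen_sq, ← D.coeffAlgHom_apply, ← D.coeffAlgHom_apply, ha, map_sub, map_add, map_one,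
        map_smul, add_one_sub_mul_eq_one_add_smul]
    ge := fun i j h => by
      rw [gen_mul, tiesAlgAction_simple_of_idxDist_ne_one cs h]
    gge := fun i j h => by
      rw [mul_assoc, gen_mul, tiesAlgAction_simple_comm cs h, ← mul_assoc, gen_mul,
        ← AlgEquiv.mul_apply, ← map_mul, cs.simple_mul_simple_self, map_one, AlgEquiv.one_apply]
    ee := fun i j => by
      rw [← map_mul, mul_comm, map_mul]
    idem := fun i => by
      rw [pow_two, ← map_mul, tieElt_mul_self]
    eeg := fun i j h => by
      rw [mul_assoc _ (D.gen j), gen_mul, ← mul_assoc, ← map_mul, ← map_mul,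
        tieElt_mul_tiesAlgAction_self cs h]
    ege := fun i j h => by
      rw [mul_assoc _ (D.gen j), mul_assoc (D.gen j), gen_mul, ← map_mul, gen_mul,
        tiesAlgAction_simple_mul cs, ← mul_assoc, ← map_mul, tieElt_mul_tiesAlgAction_self cs h] }

theorem exists_marinRing_algHom {E : Type*} [Ring E] [Algebra R E] {γ τ : Fin m → E}
    (H : IsBTFamily (q : R) γ τ) :
    ∃ f : ((identity cs).marinDatum u hu).MarinRing →ₐ[R] E,
      (∀ i, f (((identity cs).marinDatum u hu).gen i) = γ i) ∧
      ∀ i, f (((identity cs).marinDatum u hu).coeff ((identity cs).tieElt i)) = τ i := by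
  obtain ⟨v, rfl⟩ : ∃ v : Fin m → Eˣ, γ = fun i => (v i : E) :=
    ⟨fun i => (H.isUnit_g i).unit, rfl⟩
  obtain ⟨F, hF, hF_smul⟩ := H.isTieSystem.exists_tiesHom cs
  let D := (identity cs).marinDatum u hu
  let L := MonoidAlgebra.lift R E (identity cs).ties F
  have hL (i : Fin m) : L ((identity cs).tieElt i) = τ i :=
    (MonoidAlgebra.lift_of F _).trans (hF i)
  let φ : D.Braid →* Eˣ := artinLift v (fun i j h => Units.ext (H.gg i j h))
    fun i j h => Units.ext (H.ggg i j h)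
  have hφ (i : Fin m) : φ (D.braidGen i) = v i := artinLift_artinGen _ _ i
  have hcomm (i : Fin m) (c) :
      φ (D.braidGen i) * L c = L (D.ρ (cs.simple i) c) * φ (D.braidGen i) := by
    rw [hφ]
    refine (identity cs).mul_lift_eq_lift_tiesAlgAction_mul (fun x => ?_) c
    rw [hF_smul, ConjAct.units_smul_def, ConjAct.ofConjAct_toConjAct, Units.inv_mul_cancel_right]
  have hquad (i : Fin m) :
      (φ (D.braidGen i) : E) ^ 2 = L (D.a i) + L (1 - D.a i) * φ (D.braidGen i) := by
    rw [hφ, H.quadratic, coe_marinDatum_a cs hu hq, map_sub, map_add, map_one, map_smul, hL,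
      add_one_sub_mul_eq_one_add_smul]
  refine ⟨MarinDatum.lift L φ hcomm hquad, fun i => ?_, fun i => ?_⟩
  · rw [MarinDatum.lift_gen, hφ]
  · rw [MarinDatum.lift_coeff, hL]

end JuyumayaMap

end BraidsTies

end

open BraidsTies in
theorem mainTheorem4 {R : Type*} [CommRing R] (n : ℕ) {W : Type*} [Group W]
    (cs : CoxeterSystem (CoxeterMatrix.A (n - 1)) W)
    (u : Fin (n - 1) → Rˣ) (hu : ConjInvariant cs u) :
    (∃ q : Rˣ, ∀ i, u i = q) ∧
    ∀ q : Rˣ, (∀ i, u i = q) →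
      ∃ f : BTAlgebra R n (q : R) ≃ₐ[R]
          ((JuyumayaMap.identity cs).marinDatum u hu).MarinRing,
        (∀ i, f (BTAlgebra.g (q : R) i) =
          ((JuyumayaMap.identity cs).marinDatum u hu).gen i) ∧
        (∀ i, f (BTAlgebra.e (q : R) i) =
          ((JuyumayaMap.identity cs).marinDatum u hu).coeff
            ((JuyumayaMap.identity cs).tieElt i)) := by
  refine ⟨hu.exists_eq, fun q hq => ?_⟩
  have hMarin := JuyumayaMap.isBTFamily_marinRing cs hu hq
  obtain ⟨f, hfg, hfe⟩ :=
    JuyumayaMap.exists_marinRing_algHom cs hu hq (BTAlgebra.isBTFamily (q : R))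
  have left : (BTAlgebra.lift hMarin).comp f = AlgHom.id R _ :=
    JuyumayaMap.marinRing_algHom_ext _
      (fun i => by rw [AlgHom.comp_apply, hfg, BTAlgebra.lift_g]; rfl)
      (fun i => by rw [AlgHom.comp_apply, hfe, BTAlgebra.lift_e]; rfl)
  have right : f.comp (BTAlgebra.lift hMarin) = AlgHom.id R _ :=
    BTAlgebra.algHom_ext
      (fun i => by rw [AlgHom.comp_apply, BTAlgebra.lift_g, hfg]; rfl)
      (fun i => by rw [AlgHom.comp_apply, BTAlgebra.lift_e, hfe]; rfl)
  exact ⟨AlgEquiv.ofAlgHom (BTAlgebra.lift hMarin) f left right, BTAlgebra.lift_g hMarin,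
    BTAlgebra.lift_e hMarin⟩
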